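/- **Setting.** Let $\ell\ge 1$, let $c_1,\dots,c_{\ell-1}\in\mathbb R$, and put $\varphi_\ell(\kappa)=\kappa^\ell-\sum_{j=1}^{\ell-1}c_j\kappa^j$. Let $\alpha_1,\dots,\alpha_K$ be distinct real numbers, and for each $k$ let $\kappa_1[\alpha_k]<\dots<\kappa_{m_k}[\alpha_k]$ be distinct real roots of the spectral curve $\varphi_\ell(\kappa)=\alpha_k$ (not necessarily all of its roots). Put $N=\sum_k n_k$, $M=\sum_k m_k$, let $\kappa_1<\dots<\kappa_M$ be all the numbers $\kappa_j[\alpha_k]$ in increasing order, and let $\phi(j,k)$ be the position of $\kappa_j[\alpha_k]$ in this list. *The totally nonnegative Grassmannian.* A point of $\mathrm{Gr}(n,m)$ is represented by its $n\times m$ real matrix $A$ of rank $n$ in reduced row echelon form; $A\in\mathrm{Gr}(n,m)_{\ge0}$ means that all nonzero maximal minors of $A$ are positive. $A$ is irreducible if it has no zero column and each row has a nonzero entry besides its pivot. *Permutation.* For a matrix $A$ with columns $v_1,\dots,v_m$, $\pi(A)\in S_m$ is the permutation for which $\pi(A)(j)$ is the first column $i$, going cyclically backwards from $j$, such that $v_j\in\mathrm{span}(v_i,v_{i+1},\dots,v_{j-1})$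 (indices cyclic; $\pi(A)(j)=j$ if $v_j=0$ or if $v_j$ is not in the span of the other columns). The permutation $\pi(A[\alpha_k])$ of a matrix whose columns are labelled by $\kappa_1[\alpha_k],\dots,\kappa_{m_k}[\alpha_k]$ is regarded as a permutation of $\{1,\dots,M\}$ through $j\mapsto\phi(j,k)$, fixing all other labels. *Non-crossing.* The chord diagram of $\pi\in S_M$ has a chord $[i,\pi(i)]$ above the line for each $i<\pi(i)$ and a chord $[\pi(i),i]$ below the line for each $i>\pi(i)$. Two permutations are non-crossing if no chord $[a,b]$ of one and chord $[c,d]$ of the other on the same side of the line satisfy $a<c<b<d$ or $c<a<d<b$. *$\kappa$-direct sum.* $\widehat\bigoplus_kA[\alpha_k]$ is the $N\times M$ block matrix whose rows are the rows of the $A[\alpha_k]$, the $j$-th entry of a row of $A[\alpha_k]$ being placed in column $\phi(j,k)$ with zeros in all other columns, and whose rows are ordered by the positions of their pivots. *Solitons.* For times $\mathbf t=(t_1,t_2,\dots)$ with finitely many nonzero entries and an $N\times M$ matrix $A=(a_{i,j})$, put $f_i(\mathbf t)=\sum_ja_{i,j}\exp\bigl(\sum_{r\ge1}\kappa_j^rt_r\bigr)$,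 $\tau=\mathrm{Wr}(f_1,\dots,f_N)$ with respect to $x=t_1$, and $u=2\,\partial_x^2\ln\tau$. **Theorem.** Let $A[\alpha_k]\in\mathrm{Gr}(n_k,m_k)_{\ge0}$ for $k=1,\dots,K$, and suppose that $\pi(A[\alpha_i])$ and $\pi(A[\alpha_j])$ are non-crossing for all $i\ne j$. Then $\widehat\bigoplus_{k=1}^KA[\alpha_k]$ is in reduced row echelon form, and there is exactly one matrix $A[\alpha_1,\dots,\alpha_K]\in\mathrm{Gr}(N,M)_{\ge0}$ in reduced row echelon form that is obtained from it by changing the signs of some entries. This matrix satisfies $$\pi(A[\alpha_1,\dots,\alpha_K])=\prod_{k=1}^K\pi(A[\alpha_k]),$$ and if all $A[\alpha_k]$ are irreducible, then so is $A[\alpha_1,\dots,\alpha_K]$, and its permutation is a derangement (has no fixed point). Moreover, the soliton parameters $(\kappa_1,\dots,\kappa_M)$ and $A[\alpha_1,\dots,\alpha_K]$ give a regular KP soliton of the $\ell$-reduction: $\tau(\mathbf t)>0$ for all $\mathbf t$; $u$ is smooth and solves the KP equation $$\partial_x\bigl(-4u_t+6uu_x+u_{xxx}\bigr)+3u_{yy}=0\qquad(x=t_1,\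 y=t_2,\ t=t_3);$$ if the $i$-th row of $\widehat\bigoplus_kA[\alpha_k]$ comes from $A[\alpha_k]$, then $\partial_x^\ell f_i-\sum_{r=1}^{\ell-1}c_r\,\partial_x^rf_i=\alpha_kf_i$; and $u$ is constant along the direction $\partial_{t_\ell}-\sum_{r=1}^{\ell-1}c_r\,\partial_{t_r}$. -/

import Mathlib

noncomputable section

open scoped Matrix

namespace KPSoliton

/-! ### The totally nonnegative Grassmannian

A point of `Gr(n,m)` (an `n`-dimensional subspace of `ℝ^m`) is represented by the unique `n × m`
matrix in reduced row echelon form, without zero rows, whose rows span it. -/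

/-- Full-rank reduced row echelon form: `p i` is the pivot column of row `i`. -/
def IsRREF {n m : ℕ} (A : Matrix (Fin n) (Fin m) ℝ) : Prop :=
  ∃ p : Fin n → Fin m, StrictMono p ∧ (∀ i, ∀ j < p i, A i j = 0) ∧
    ∀ i i', A i' (p i) = if i' = i then 1 else 0

/-- The maximal minor `Δ_I(A)` on the columns `I = {I 0 < I 1 < ⋯}`. -/
def maxMinor {n m : ℕ} (A : Matrix (Fin n) (Fin m) ℝ) (I : Fin n ↪o Fin m) : ℝ :=
  (A.submatrix id I).det

/-- The matroid `M(A)`: the column sets with nonzero maximal minor. -/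
def matroid {n m : ℕ} (A : Matrix (Fin n) (Fin m) ℝ) : Set (Fin n ↪o Fin m) :=
  {I | maxMinor A I ≠ 0}

/-- `A` is (the reduced row echelon representative of) an element of `Gr(n,m)_{≥0}`. -/
def IsTNN {n m : ℕ} (A : Matrix (Fin n) (Fin m) ℝ) : Prop :=
  IsRREF A ∧ ∀ I ∈ matroid A, 0 < maxMinor A I

/-- Irreducibility of a matrix in reduced row echelon form: no zero column, and every row has a
nonzero entry besides its pivot. -/
def IsIrreducible {n m : ℕ} (A : Matrix (Fin n) (Fin m) ℝ) : Prop :=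
  (∀ j, ∃ i, A i j ≠ 0) ∧ ∀ i, ∃ j j', j ≠ j' ∧ A i j ≠ 0 ∧ A i j' ≠ 0

/-! ### The permutation `π(A)` -/

/-- The column index `z` steps after `j` in the cyclic order of `Fin m` (`z` may be negative). -/
def cyc {m : ℕ} (z : ℤ) (j : Fin m) : Fin m := ((finRotate m) ^ z) j

/-- The number of cyclically preceding columns `j-1, j-2, …` that are needed
for their span to contain the column `j`. It is `0` if the column `j` is zero, and `m` if the
column `j` is not in the span of the other columns. -/
def backDist {n m : ℕ} (A : Matrix (Fin n) (Fin m) ℝ) (j : Fin m) : ℕ :=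
  sInf {d | Aᵀ j ∈ Submodule.span ℝ ((fun e : ℕ => Aᵀ (cyc (-(e : ℤ)) j)) '' Set.Icc 1 d)}

/-- `π(A)` as a map: `π(A)(j)` is the first column `i`, going cyclically backwards from `j`, such
that column `j` lies in the span of the columns `i, i+1, …, j-1`. -/
def permFun {n m : ℕ} (A : Matrix (Fin n) (Fin m) ℝ) (j : Fin m) : Fin m :=
  cyc (-(backDist A j : ℤ)) j

theorem finRotate_pow_self (m : ℕ) : (finRotate m) ^ m = 1 := by
  match m with
  | 0 => rfl
  | 1 => exact Subsingleton.elim _ _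
  | n + 2 =>
    have h := (isCycle_finRotate (n := n)).orderOf
    rw [support_finRotate, Finset.card_univ, Fintype.card_fin] at h
    have h' := pow_orderOf_eq_one (finRotate (n + 2))
    rwa [h] at h'

theorem cyc_cyc {m : ℕ} (a b : ℤ) (j : Fin m) : cyc a (cyc b j) = cyc (a + b) j := by
  simp [cyc, zpow_add]

theorem cyc_succ_cyc {m : ℕ} (d : ℕ) (j : Fin m) :
    cyc ((d + 1 : ℕ) : ℤ) (cyc (-((d + 1 : ℕ) : ℤ)) j) = j := by
  rw [cyc_cyc]
  simp [cyc]

theorem backDist_mem {n m : ℕ} (A : Matrix (Fin n) (Fin m) ℝ) (j : Fin m) :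
    Aᵀ j ∈ Submodule.span ℝ
      ((fun e : ℕ => Aᵀ (cyc (-(e : ℤ)) j)) '' Set.Icc 1 (backDist A j)) := by
  apply Nat.sInf_mem (s := {d | Aᵀ j ∈ Submodule.span ℝ
    ((fun e : ℕ => Aᵀ (cyc (-(e : ℤ)) j)) '' Set.Icc 1 d)})
  refine ⟨m, Submodule.subset_span ⟨m, ⟨Nat.one_le_iff_ne_zero.2 ?_, le_rfl⟩, ?_⟩⟩
  · rintro rfl
    exact j.elim0
  · simp [cyc, finRotate_pow_self]

theorem backDist_eq {n m : ℕ} (A : Matrix (Fin n) (Fin m) ℝ) (j : Fin m) :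
    backDist A j = sInf {d | Aᵀ (permFun A j) ∈ Submodule.span ℝ
      ((fun e : ℕ => Aᵀ (cyc (e : ℤ) (permFun A j))) '' Set.Icc 1 d)} := by
  have hmem := backDist_mem A j
  have hnot : ∀ d < backDist A j, Aᵀ j ∉ Submodule.span ℝ
      ((fun e : ℕ => Aᵀ (cyc (-(e : ℤ)) j)) '' Set.Icc 1 d) := fun d hd =>
    Nat.notMem_of_lt_sInf hd
  unfold permFun
  generalize backDist A j = d at hmem hnot
  rcases d with _ | d
  · symm
    rw [Nat.sInf_eq_zero]
    left
    simpa [cyc] using hmem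
  · have hIcc : Set.Icc 1 (d + 1) = insert (d + 1) (Set.Icc 1 d) := by
      ext x; simp; omega
    have hS : (fun e : ℕ => Aᵀ (cyc (e : ℤ) (cyc (-((d + 1 : ℕ) : ℤ)) j))) '' Set.Icc 1 d
        = (fun e : ℕ => Aᵀ (cyc (-(e : ℤ)) j)) '' Set.Icc 1 d := by
      ext w
      constructor
      · rintro ⟨e, ⟨h1, h2⟩, rfl⟩
        refine ⟨d + 1 - e, ⟨by omega, by omega⟩, ?_⟩
        simp only [cyc_cyc]
        congr 2
        omega
      · rintro ⟨e, ⟨h1, h2⟩, rfl⟩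
        refine ⟨d + 1 - e, ⟨by omega, by omega⟩, ?_⟩
        simp only [cyc_cyc]
        congr 2
        omega
    have hn := hnot d (Nat.lt_succ_self d)
    rw [hIcc, Set.image_insert_eq] at hmem
    have hex := mem_span_insert_exchange hmem hn
    apply le_antisymm
    · apply le_csInf
      · refine ⟨d + 1, ?_⟩
        rw [Set.mem_ofPred_eq, hIcc, Set.image_insert_eq, hS, cyc_succ_cyc]
        exact hex
      · intro b hb
        by_contra hlt
        apply hn
        have hb' : Aᵀ (cyc (-((d + 1 : ℕ) : ℤ)) j) ∈ Submodule.span ℝ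
            ((fun e : ℕ => Aᵀ (cyc (-(e : ℤ)) j)) '' Set.Icc 1 d) := by
          rw [← hS]
          exact Submodule.span_mono
            (Set.image_mono (Set.Icc_subset_Icc_right (by omega))) hb
        rwa [Submodule.span_insert_eq_span hb'] at hmem
    · apply Nat.sInf_le
      rw [Set.mem_ofPred_eq, hIcc, Set.image_insert_eq, hS, cyc_succ_cyc]
      exact hex

theorem permFun_injective {n m : ℕ} (A : Matrix (Fin n) (Fin m) ℝ) :
    Function.Injective (permFun A) := by
  intro j j' h
  have hd : backDist A j = backDist A j' := by rw [backDist_eq, backDist_eq, h]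
  unfold permFun at h
  rw [hd] at h
  exact ((finRotate m) ^ (-(backDist A j' : ℤ))).injective h

/-- The permutation `π(A)` of the columns of `A`. -/
def perm {n m : ℕ} (A : Matrix (Fin n) (Fin m) ℝ) : Equiv.Perm (Fin m) :=
  Equiv.ofBijective (permFun A) (Finite.injective_iff_bijective.1 (permFun_injective A))

/-! ### Chord diagrams and non-crossing permutations -/

/-- The chords `[a,b]` and `[c,d]` (with `a < b`, `c < d`) on the same side of the line cross. -/
def ChordsCross {M : ℕ} (a b c d : Fin M) : Prop :=
  (a < c ∧ c < b ∧ b < d) ∨ (c < a ∧ a < d ∧ d < b)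

/-- No chord of the chord diagram of `σ` crosses a chord of the chord diagram of `ρ`. In the chord
diagram of `σ`, an exceedance `i < σ i` is a chord `[i, σ i]` above the line, and a deficiency
`σ i < i` is a chord `[σ i, i]` below the line. -/
def NonCrossing {M : ℕ} (σ ρ : Equiv.Perm (Fin M)) : Prop :=
  (∀ i j, i < σ i → j < ρ j → ¬ ChordsCross i (σ i) j (ρ j)) ∧
  (∀ i j, σ i < i → ρ j < j → ¬ ChordsCross (σ i) i (ρ j) j)

/-! ### The sorted parameters and the `κ`-direct sum -/

section DirectSum

variable {K : ℕ}

/-- The pairs `(k, j)`, `j < s k`, listed in the order of increasing `key`. -/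
def sortedPairs (s : Fin K → ℕ) (key : (Σ k, Fin (s k)) → ℝ) :
    Fin (∑ k, s k) ≃ Σ k, Fin (s k) :=
  (Tuple.sort (key ∘ finSigmaFinEquiv.symm)).trans finSigmaFinEquiv.symm

/-- The pairs `(k, j)` listed in the order of increasing `κ_j[α_k]`; the inverse of the bijection
`(j, k) ↦ φ(j, k)`. -/
def colOrder (m : Fin K → ℕ) (κ : ∀ k, Fin (m k) → ℝ) : Fin (∑ k, m k) ≃ Σ k, Fin (m k) :=
  sortedPairs m fun q => κ q.1 q.2

/-- The ordered parameters `κ_1 < ⋯ < κ_M`. -/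
def sortedKappa (m : Fin K → ℕ) (κ : ∀ k, Fin (m k) → ℝ) (j : Fin (∑ k, m k)) : ℝ :=
  κ (colOrder m κ j).1 (colOrder m κ j).2

/-- The rows of all the blocks, listed in the order of the parameters `κ` of their pivots (the
first nonzero entries). -/
def rowOrder (n m : Fin K → ℕ) (κ : ∀ k, Fin (m k) → ℝ)
    (A : ∀ k, Matrix (Fin (n k)) (Fin (m k)) ℝ) : Fin (∑ k, n k) ≃ Σ k, Fin (n k) :=
  sortedPairs n fun q => sInf (κ q.1 '' {j | A q.1 q.2 j ≠ 0})

/-- The `κ`-direct sum of the matrices `A[α_k]`: block diagonal, the columns sorted by `κ` and the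
rows sorted by their pivots. -/
def directSum (n m : Fin K → ℕ) (κ : ∀ k, Fin (m k) → ℝ)
    (A : ∀ k, Matrix (Fin (n k)) (Fin (m k)) ℝ) :
    Matrix (Fin (∑ k, n k)) (Fin (∑ k, m k)) ℝ :=
  (Matrix.blockDiagonal' A).submatrix (rowOrder n m κ A) (colOrder m κ)

/-- The position `φ(j, k)` of `κ_j[α_k]` among the sorted parameters. -/
def position (m : Fin K → ℕ) (κ : ∀ k, Fin (m k) → ℝ) (k : Fin K) :
    Fin (m k) ↪ Fin (∑ k, m k) :=
  (Function.Embedding.sigmaMk k).trans (colOrder m κ).symm.toEmbedding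

/-- `π(A[α_k])` written in the sorted labels: a permutation of `Fin M` that moves only the labels
`φ(j, k)`. -/
def blockPerm (n m : Fin K → ℕ) (κ : ∀ k, Fin (m k) → ℝ)
    (A : ∀ k, Matrix (Fin (n k)) (Fin (m k)) ℝ) (k : Fin K) : Equiv.Perm (Fin (∑ k, m k)) :=
  (perm (A k)).viaEmbedding (position m κ k)

end DirectSum

/-- `A'` arises from `B` by changing the signs of some entries. -/
def SignAdjustment {N M : ℕ} (B A' : Matrix (Fin N) (Fin M) ℝ) : Prop :=
  ∀ i j, A' i j = B i j ∨ A' i j = -B i j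

/-! ### The spectral curve -/

/-- `Φ_ℓ(κ, α) = φ_ℓ(κ) - α` with `φ_ℓ(κ) = κ^ℓ - ∑_{j=1}^{ℓ-1} c_j κ^j`, as a polynomial in `κ`. -/
def spectralCurve (ℓ : ℕ+) (c : ℕ+ → ℝ) (α : ℝ) : Polynomial ℝ :=
  Polynomial.X ^ (ℓ : ℕ)
    - ∑ j ∈ Finset.Ico 1 ℓ, Polynomial.C (c j) * Polynomial.X ^ (j : ℕ) - Polynomial.C α

/-! ### KP solitons and the `ℓ`-reduction -/

/-- The times `t = (t_1, t_2, …)`, finitely many of them nonzero. -/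
abbrev Times : Type := ℕ+ →₀ ℝ

/-- The partial derivative `∂F/∂t_r`. -/
def partialT (r : ℕ+) (F : Times → ℝ) (t : Times) : ℝ :=
  deriv (fun s : ℝ => F (t + Finsupp.single r s)) 0

/-- `F` is a smooth function on every finite-dimensional affine space of times. -/
def SmoothInTimes (F : Times → ℝ) : Prop :=
  ∀ (t : Times) (r : ℕ) (d : Fin r → Times),
    ContDiff ℝ (⊤ : ℕ∞) (fun s : Fin r → ℝ => F (t + ∑ i, s i • d i))

/-- The exponential function `exp (∑_{r ≥ 1} κ^r t_r)`. -/
def expFun (κ : ℝ) (t : Times) : ℝ := Real.exp (t.sum fun r a => κ ^ (r : ℕ) * a)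

section Soliton

variable {N M : ℕ}

/-- `f_i(t) = ∑_j a_{i,j} E_j(t)`. -/
def solF (κ : Fin M → ℝ) (A : Matrix (Fin N) (Fin M) ℝ) (i : Fin N) (t : Times) : ℝ :=
  ∑ j, A i j * expFun (κ j) t

/-- The `τ`-function: the Wronskian `Wr(f_1, …, f_N)` with respect to `x = t_1`. -/
def tau (κ : Fin M → ℝ) (A : Matrix (Fin N) (Fin M) ℝ) (t : Times) : ℝ :=
  (Matrix.of fun (r i : Fin N) => (partialT 1)^[(r : ℕ)] (solF κ A i) t).det

/-- `u = 2 ∂_x² ln τ`. -/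
def solU (κ : Fin M → ℝ) (A : Matrix (Fin N) (Fin M) ℝ) : Times → ℝ := fun t =>
  2 * (partialT 1)^[2] (fun t' => Real.log (tau κ A t')) t

/-- The KP equation `∂_x (-4 u_t + 6 u u_x + u_xxx) + 3 u_yy = 0`, where `x = t_1`, `y = t_2`,
`t = t_3`. -/
def SolvesKP (u : Times → ℝ) : Prop :=
  ∀ t, partialT 1 (fun t' => -4 * partialT 3 u t' + 6 * u t' * partialT 1 u t'
      + (partialT 1)^[3] u t') t + 3 * (partialT 2)^[2] u t = 0

/-- The soliton parameters `(κ, A)` give a regular KP soliton: the parameters are ordered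
`κ_1 < ⋯ < κ_M`, the `τ`-function is positive for all times, and `u = 2 ∂_x² ln τ` is a smooth
solution of the KP equation. -/
def IsKPSoliton (κ : Fin M → ℝ) (A : Matrix (Fin N) (Fin M) ℝ) : Prop :=
  StrictMono κ ∧ (∀ t, 0 < tau κ A t) ∧ SmoothInTimes (solU κ A) ∧ SolvesKP (solU κ A)

/-- The soliton parameters `(κ, A)` satisfy the `ℓ`-reduction with the deformation parameters `c`,
where `a i` is the constant `α_k` that belongs to the row `i`: each `f_i` satisfies
`∂_x^ℓ f_i - ∑_{r=1}^{ℓ-1} c_r ∂_x^r f_i = a i * f_i`, and `u` does not depend on `t_ℓ` in the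
coordinates in which `∂/∂t_ℓ` stands for `∂/∂t_ℓ - ∑_{r=1}^{ℓ-1} c_r ∂/∂t_r`. -/
def IsReduced (ℓ : ℕ+) (c : ℕ+ → ℝ) (a : Fin N → ℝ) (κ : Fin M → ℝ)
    (A : Matrix (Fin N) (Fin M) ℝ) : Prop :=
  (∀ i t, (partialT 1)^[(ℓ : ℕ)] (solF κ A i) t
      - ∑ r ∈ Finset.Ico 1 ℓ, c r * (partialT 1)^[(r : ℕ)] (solF κ A i) t = a i * solF κ A i t) ∧
  ∀ (t : Times) (s : ℝ),
    solU κ A (t + (Finsupp.single ℓ s - ∑ r ∈ Finset.Ico 1 ℓ, Finsupp.single r (c r * s)))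
      = solU κ A t

end Soliton

end KPSoliton

end

/-! Let B be the κ-direct sum and P its set of pivot columns. Call a pair of columns an inversion if
their blocks are ordered oppositely to the columns, and let inv(I,J) count the inversions with one
column in I and the other in J, in this order. A nonzero maximal minor of B on columns I forces I to
be a union of bases of the blocks. It is then the product of the block minors times
(-1)^(inv(P,P)+inv(I,I)), the signs of the two shuffles that make the submatrix block diagonal
(`exists_lists`, `Lists.maxMinor_eq`, `Lists.sign_eq`). Multiply column j by ε(j) and row i by ε(P
i), where ε(j) is the parity of the inversions between j and P. The row signs have product 1, and
the column signs contribute (-1)^(inv(I,P)+inv(P,I)). Positivity thus follows from inv(I,I)+inv(P,P)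
= inv(I,P)+inv(P,I), that is, from the vanishing of the inversion form at f = 1_I - 1_P
(`inversion_count`).

This is proved for each pair of blocks, with column sets S, T and permutations σ, ρ. Two facts are
combined. A π-invariant interval of columns contains equally many elements of every basis, because
its span is independent of the span of the remaining columns (`disjoint_span_of_invariant`); so f
sums to zero over invariant intervals. And the non-crossing condition makes every cycle of one
permutation lie in a gap of each cycle of the other (`cycles_noncrossing`). Points of T are called
equivalent if the interval between them is σ-invariant. Then the sum of f over the part of S to the
right of b depends only on the class of b. The classes are non-crossing and unions of ρ-cycles, so f
sums to zero over each of them (`sum_class_eq_zero`). The double sum therefore vanishes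
(`sum_inversions_eq_zero`).

Uniqueness holds because each non-pivot entry of an echelon matrix is a maximal minor up to a sign
fixed by the pivots. The permutation splits because linear relations among the columns split by
block.

For the soliton, τ = det(A E V) with E the diagonal matrix of exponentials and V a Vandermonde
matrix; Cauchy–Binet makes it positive. Put Q = V (A E V)⁻¹ A E and D = diag κ. Then Q is
idempotent, ∂_r Q = Q D^r (1 - Q) and ∂_r ln τ = tr(Q D^r), so the Hirota form of KP becomes an
identity between traces of words in Q, 1 - Q, D. It holds because (1 - Q) D Q has rank at most one
(`trace_hirota`, `exists_waveProj_rank_one`). The reduction holds because each row is supported on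
the roots of a single spectral curve. -/

noncomputable section

open scoped Matrix

namespace KPSoliton

/-! ### Line derivatives of matrix-valued functions -/

section MatrixLineDeriv

variable {E : Type*} [AddCommGroup E] [Module ℝ E] {a b c : Type*}

/-- `F'` is the derivative of the matrix-valued function `F` in the direction `v`. -/
def HasMatrixLineDeriv (F F' : E → Matrix a b ℝ) (v : E) : Prop :=
  ∀ x i j, HasLineDerivAt ℝ (fun y => F y i j) (F' x i j) x v

variable {v : E}

theorem HasMatrixLineDeriv.const (B : Matrix a b ℝ) :
    HasMatrixLineDeriv (fun _ : E => B) (fun _ => 0) v := fun _ _ _ =>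
  hasDerivAt_const _ _

theorem HasMatrixLineDeriv.sub {F F' G G' : E → Matrix a b ℝ} (hF : HasMatrixLineDeriv F F' v)
    (hG : HasMatrixLineDeriv G G' v) :
    HasMatrixLineDeriv (fun x => F x - G x) (fun x => F' x - G' x) v := fun x i j =>
  HasDerivAt.fun_sub (hF x i j) (hG x i j)

theorem HasMatrixLineDeriv.mul [Fintype b] {F F' : E → Matrix a b ℝ} {G G' : E → Matrix b c ℝ}
    (hF : HasMatrixLineDeriv F F' v) (hG : HasMatrixLineDeriv G G' v) :
    HasMatrixLineDeriv (fun x => F x * G x) (fun x => F' x * G x + F x * G' x) v := by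
  intro x i j
  have h : HasDerivAt (fun t : ℝ => ∑ k, F (x + t • v) i k * G (x + t • v) k j)
      (∑ k, (F' x i k * G (x + (0 : ℝ) • v) k j + F (x + (0 : ℝ) • v) i k * G' x k j)) 0 :=
    HasDerivAt.fun_sum fun k _ => (hF x i k).fun_mul (hG x k j)
  simpa [HasLineDerivAt, Matrix.mul_apply, Finset.sum_add_distrib] using h

theorem HasMatrixLineDeriv.trace [Fintype a] {F F' : E → Matrix a a ℝ}
    (hF : HasMatrixLineDeriv F F' v) (x : E) :
    HasLineDerivAt ℝ (fun y => (F y).trace) (F' x).trace x v :=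
  HasDerivAt.fun_sum fun i _ => hF x i i

theorem HasMatrixLineDeriv.congr {F F' G' : E → Matrix a b ℝ} (hF : HasMatrixLineDeriv F F' v)
    (h : ∀ x, F' x = G' x) : HasMatrixLineDeriv F G' v := fun x i j => h x ▸ hF x i j

variable [Fintype a] [DecidableEq a]

/-- Jacobi's formula. -/
theorem HasMatrixLineDeriv.det {F F' : E → Matrix a a ℝ} (hF : HasMatrixLineDeriv F F' v) (x : E) :
    HasLineDerivAt ℝ (fun y => (F y).det) ((F x).adjugate * F' x).trace x v := by
  have h : HasDerivAt (fun t : ℝ => ∑ σ : Equiv.Perm a, ((Equiv.Perm.sign σ : ℤ) : ℝ) *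
      ∏ i, F (x + t • v) (σ i) i) (∑ σ : Equiv.Perm a, ((Equiv.Perm.sign σ : ℤ) : ℝ) *
        ∑ i, (∏ j ∈ Finset.univ.erase i, F (x + (0 : ℝ) • v) (σ j) j) • F' x (σ i) i) 0 :=
    HasDerivAt.fun_sum fun σ _ => HasDerivAt.const_mul _
      (HasDerivAt.fun_finsetProd fun i _ => hF x (σ i) i)
  have e : ((F x).adjugate * F' x).trace = ∑ σ : Equiv.Perm a, ((Equiv.Perm.sign σ : ℤ) : ℝ) *
        ∑ i, (∏ j ∈ Finset.univ.erase i, F (x + (0 : ℝ) • v) (σ j) j) • F' x (σ i) i := by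
    have h1 : ∀ i, ((F x).adjugate * F' x) i i =
        ((F x).updateCol i (fun k => F' x k i)).det := by
      intro i
      rw [← Matrix.cramer_apply, Matrix.cramer_eq_adjugate_mulVec]
      rfl
    simp only [Matrix.trace, Matrix.diag, h1, Matrix.det_apply', Finset.mul_sum]
    rw [Finset.sum_comm]
    refine Finset.sum_congr rfl fun σ _ => Finset.sum_congr rfl fun i _ => ?_
    rw [← Finset.mul_prod_erase _ _ (Finset.mem_univ i)]
    simp only [Matrix.updateCol_self, zero_smul, add_zero, smul_eq_mul]
    rw [mul_comm (F' x (σ i) i)]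
    congr 2
    refine Finset.prod_congr rfl fun j hj => ?_
    rw [Matrix.updateCol_ne (Finset.ne_of_mem_erase hj)]
  rw [e]
  simpa only [HasLineDerivAt, Matrix.det_apply'] using h

/-- The entries of the inverse are quotients of determinants, so Jacobi's formula gives
differentiability. The value of the derivative is then forced by differentiating F⁻¹ F = 1. -/
theorem HasMatrixLineDeriv.inv {F F' : E → Matrix a a ℝ} (hF : HasMatrixLineDeriv F F' v)
    (h0 : ∀ x, (F x).det ≠ 0) :
    HasMatrixLineDeriv (fun x => (F x)⁻¹) (fun x => -((F x)⁻¹ * F' x * (F x)⁻¹)) v := by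
  have hdiff : ∀ x i j, ∃ d, HasLineDerivAt ℝ (fun y => (F y)⁻¹ i j) d x v := by
    intro x i j
    have hU : HasMatrixLineDeriv (fun y => (F y).updateRow j (Pi.single i 1))
        (fun y => (F' y).updateRow j 0) v := by
      intro y k l
      by_cases hk : k = j
      · subst hk
        simpa [HasLineDerivAt] using hasDerivAt_const (0 : ℝ) ((Pi.single i 1 : a → ℝ) l)
      · simpa [Matrix.updateRow_ne hk] using hF y k l
    have h2 := HasDerivAt.fun_mul (HasDerivAt.fun_inv (hF.det x) (by simpa using h0 x)) (hU.det x)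
    refine ⟨_, h2.congr_of_eventuallyEq (Filter.Eventually.of_forall fun t => ?_)⟩
    simp [Matrix.inv_def, Matrix.adjugate_apply]
  choose G hG using hdiff
  have hG' : HasMatrixLineDeriv (fun x => (F x)⁻¹) (fun x => Matrix.of (G x)) v := hG
  refine hG'.congr fun x => ?_
  have h1 : HasMatrixLineDeriv (fun x => (F x)⁻¹ * F x) (fun _ => 0) v := by
    have : (fun x => (F x)⁻¹ * F x) = fun _ => (1 : Matrix a a ℝ) :=
      funext fun x => Matrix.nonsing_inv_mul _ (h0 x).isUnit
    rw [this]
    exact .const _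
  have h2 : Matrix.of (G x) * F x + (F x)⁻¹ * F' x = 0 := by
    ext i j
    exact ((hG'.mul hF) x i j).unique (h1 x i j)
  have h3 := congrArg (· * (F x)⁻¹) (eq_neg_of_add_eq_zero_left h2)
  simpa [Matrix.mul_assoc, Matrix.mul_nonsing_inv _ (h0 x).isUnit] using h3

end MatrixLineDeriv

/-! ### A trace identity -/

/-- The algebraic form of the Hirota bilinear equation of the KP hierarchy, for an idempotent `Q`
that commutes with `D` up to rank one on its range. -/
theorem trace_hirota {a : Type*} [Fintype a] [DecidableEq a] (Q D P : Matrix a a ℝ)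
    (hQ : Q * Q = Q) (hP : P = 1 - Q) (x y : a → ℝ) (hR : P * D * Q = Matrix.vecMulVec x y) :
    -4 * (Q * D ^ 3 * P * D).trace +
      ((Q * D * P * D * P * D * P * D - Q * D * Q * D * P * D * P * D
          - Q * D * P * D * Q * D * P * D).trace
        - (Q * D * P * D * Q * D * P * D + Q * D * Q * D * P * D * P * D
          - Q * D * Q * D * Q * D * P * D).trace)
      + 6 * (Q * D * P * D).trace ^ 2 + 3 * (Q * D ^ 2 * P * D ^ 2).trace = 0 := by
  have h1 : P + Q = 1 := by rw [hP]; abel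
  -- The only use of the rank-one hypothesis: X = Q D (P D Q) is an outer product, so tr X² = (tr
  -- X)².
  have hc : (Q * D * P * D * Q * D * P * D).trace = (Q * D * P * D).trace ^ 2 := by
    have e1 : (Q * D * P * D).trace = (Q * D * Matrix.vecMulVec x y).trace := by
      rw [← hR]
      conv_lhs => rw [← hQ]
      rw [show Q * Q * D * P * D = Q * (Q * D * P * D) by noncomm_ring, Matrix.trace_mul_comm]
      congr 1; noncomm_ring
    have e2 : (Q * D * P * D * Q * D * P * D).trace =
        (Q * D * Matrix.vecMulVec x y * (Q * D * Matrix.vecMulVec x y)).trace := by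
      rw [← hR]
      conv_lhs => rw [← hQ]
      rw [show Q * Q * D * P * D * (Q * Q) * D * P * D = Q * (Q * D * P * D * (Q * Q) * D * P * D)
        by noncomm_ring, Matrix.trace_mul_comm]
      congr 1; noncomm_ring
    rw [e1, e2, Matrix.mul_vecMulVec, Matrix.vecMulVec_mul_vecMulVec,
      Matrix.trace_vecMulVec, Matrix.trace_vecMulVec, dotProduct_smul, smul_eq_mul, sq,
      dotProduct_comm y]
  have hb1 : (Q * D * P * D * P * D * Q * D).trace = (Q * D * Q * D * P * D * P * D).trace := by
    rw [show Q * D * P * D * P * D * Q * D = (Q * D * P * D * P * D) * (Q * D) by noncomm_ring,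
      Matrix.trace_mul_comm]
    congr 1; noncomm_ring
  have hd1 : (Q * D * Q * D * P * D * Q * D).trace = (Q * D * Q * D * Q * D * P * D).trace := by
    rw [show Q * D * Q * D * P * D * Q * D = (Q * D * Q * D * P * D) * (Q * D) by noncomm_ring,
      Matrix.trace_mul_comm]
    congr 1; noncomm_ring
  -- Inserting P + Q = 1 between the factors D turns every trace into a sum over words; modulo
  -- cyclic rotation only four words remain, and their coefficients cancel.
  have h3 : D ^ 3 = D * (P + Q) * D * (P + Q) * D := by rw [h1]; noncomm_ring
  have h2 : D ^ 2 = D * (P + Q) * D := by rw [h1]; noncomm_ring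
  have e3 : (Q * D ^ 3 * P * D).trace = (Q * D * P * D * P * D * P * D).trace
      + (Q * D * P * D * Q * D * P * D).trace + (Q * D * Q * D * P * D * P * D).trace
      + (Q * D * Q * D * Q * D * P * D).trace := by
    rw [h3, ← Matrix.trace_add, ← Matrix.trace_add, ← Matrix.trace_add]
    congr 1; noncomm_ring
  have e2 : (Q * D ^ 2 * P * D ^ 2).trace = (Q * D * P * D * P * D * P * D).trace
      + (Q * D * P * D * P * D * Q * D).trace + (Q * D * Q * D * P * D * P * D).trace
      + (Q * D * Q * D * P * D * Q * D).trace := by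
    rw [h2, ← Matrix.trace_add, ← Matrix.trace_add, ← Matrix.trace_add]
    congr 1; noncomm_ring
  rw [e3, e2, hb1, hd1]
  simp only [Matrix.trace_sub, Matrix.trace_add]
  rw [← hc]
  ring

/-! ### Functions of the phases -/

section Phase

variable {N M : ℕ} (κ : Fin M → ℝ)

/-- The vector `(κ_1^r, …, κ_M^r)`. -/
def powVec (r : ℕ+) : Fin M → ℝ := fun j => κ j ^ (r : ℕ)

/-- The phases `θ_j(t) = ∑_r κ_j^r t_r`. -/
def phase : Times →ₗ[ℝ] (Fin M → ℝ) := Finsupp.linearCombination ℝ (powVec κ)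

theorem phase_single (r : ℕ+) (s : ℝ) : phase κ (Finsupp.single r s) = s • powVec κ r := by
  simp [phase]

theorem expFun_eq (t : Times) (j : Fin M) : expFun (κ j) t = Real.exp (phase κ t j) := by
  simp [expFun, phase, Finsupp.linearCombination_apply, Finsupp.sum, powVec, mul_comm]

/-- The derivative `∂/∂t_r` in terms of the phases. -/
def phaseDeriv (r : ℕ+) (f : (Fin M → ℝ) → ℝ) : (Fin M → ℝ) → ℝ := fun x =>
  lineDeriv ℝ f x (powVec κ r)

/-- The phases are linear in the times, so a change of t_r moves them along `powVec κ r`. This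
transfers all calculus from infinitely many times to the finite-dimensional phase space. -/
theorem partialT_phase (r : ℕ+) (f : (Fin M → ℝ) → ℝ) :
    partialT r (fun t => f (phase κ t)) = fun t => phaseDeriv κ r f (phase κ t) := by
  funext t
  simp [partialT, phaseDeriv, lineDeriv, phase_single]

theorem iterate_partialT_phase (r : ℕ+) (f : (Fin M → ℝ) → ℝ) (k : ℕ) :
    (partialT r)^[k] (fun t => f (phase κ t)) =
      fun t => (phaseDeriv κ r)^[k] f (phase κ t) := by
  induction k generalizing f with
  | zero => rfl
  | succ k ih => rw [Function.iterate_succ_apply, partialT_phase, ih, Function.iterate_succ_apply]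

variable {κ}

theorem phaseDeriv_eq {f : (Fin M → ℝ) → ℝ} (hf : ContDiff ℝ (⊤ : ℕ∞) f) (r : ℕ+) :
    phaseDeriv κ r f = fun x => fderiv ℝ f x (powVec κ r) := by
  funext x
  exact (hf.differentiable (by simp) x).lineDeriv_eq_fderiv

theorem contDiff_phaseDeriv {f : (Fin M → ℝ) → ℝ} (hf : ContDiff ℝ (⊤ : ℕ∞) f) (r : ℕ+) :
    ContDiff ℝ (⊤ : ℕ∞) (phaseDeriv κ r f) := by
  rw [phaseDeriv_eq hf]
  exact (hf.fderiv_right (m := (⊤ : ℕ∞)) (by simp)).clm_apply contDiff_const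

theorem phaseDeriv_add {f g : (Fin M → ℝ) → ℝ} (hf : ContDiff ℝ (⊤ : ℕ∞) f)
    (hg : ContDiff ℝ (⊤ : ℕ∞) g) (r : ℕ+) :
    phaseDeriv κ r (fun x => f x + g x) = fun x => phaseDeriv κ r f x + phaseDeriv κ r g x := by
  rw [phaseDeriv_eq hf, phaseDeriv_eq hg, phaseDeriv_eq (hf.add hg)]
  funext x
  rw [fderiv_fun_add (hf.differentiable (by simp) x) (hg.differentiable (by simp) x)]
  rfl

theorem phaseDeriv_mul {f g : (Fin M → ℝ) → ℝ} (hf : ContDiff ℝ (⊤ : ℕ∞) f)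
    (hg : ContDiff ℝ (⊤ : ℕ∞) g) (r : ℕ+) :
    phaseDeriv κ r (fun x => f x * g x) =
      fun x => phaseDeriv κ r f x * g x + f x * phaseDeriv κ r g x := by
  rw [phaseDeriv_eq hf, phaseDeriv_eq hg, phaseDeriv_eq (hf.mul hg)]
  funext x
  rw [fderiv_fun_mul (hf.differentiable (by simp) x) (hg.differentiable (by simp) x)]
  simp [mul_comm, add_comm]

theorem phaseDeriv_const_mul {f : (Fin M → ℝ) → ℝ} (hf : ContDiff ℝ (⊤ : ℕ∞) f) (c : ℝ) (r : ℕ+) :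
    phaseDeriv κ r (fun x => c * f x) = fun x => c * phaseDeriv κ r f x := by
  rw [phaseDeriv_mul contDiff_const hf]
  funext x
  simp [phaseDeriv, lineDeriv]

theorem phaseDeriv_comm {f : (Fin M → ℝ) → ℝ} (hf : ContDiff ℝ (⊤ : ℕ∞) f) (r s : ℕ+) :
    phaseDeriv κ r (phaseDeriv κ s f) = phaseDeriv κ s (phaseDeriv κ r f) := by
  have h : ∀ r s : ℕ+, phaseDeriv κ r (phaseDeriv κ s f) =
      fun x => fderiv ℝ (fderiv ℝ f) x (powVec κ r) (powVec κ s) := by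
    intro r s
    rw [phaseDeriv_eq (contDiff_phaseDeriv hf s), phaseDeriv_eq hf]
    funext x
    have hd : DifferentiableAt ℝ (fderiv ℝ f) x :=
      (hf.fderiv_right (m := (⊤ : ℕ∞)) (by simp)).differentiable (by simp) x
    rw [fderiv_clm_apply hd (differentiableAt_const _)]
    simp
  rw [h, h]
  funext x
  exact (hf.contDiffAt.isSymmSndFDerivAt
    (by simpa using WithTop.coe_le_coe.2 (le_top (a := (2 : ℕ∞))))) _ _

theorem smoothInTimes_phase {f : (Fin M → ℝ) → ℝ} (hf : ContDiff ℝ (⊤ : ℕ∞) f) :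
    SmoothInTimes fun t => f (phase κ t) := by
  intro t r d
  have : (fun s : Fin r → ℝ => f (phase κ (t + ∑ i, s i • d i))) =
      fun s : Fin r → ℝ => f (phase κ t + ∑ i, s i • phase κ (d i)) := by
    funext s
    simp
  rw [this]
  exact hf.comp (by fun_prop)

/-- The Hirota form of the KP equation for `L = ln τ` implies the KP equation for `u = 2 L_xx`. -/
theorem solvesKP_of_hirota {L : (Fin M → ℝ) → ℝ} (hL : ContDiff ℝ (⊤ : ℕ∞) L)
    (h : ∀ x, -4 * phaseDeriv κ 1 (phaseDeriv κ 3 L) x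
      + phaseDeriv κ 1 (phaseDeriv κ 1 (phaseDeriv κ 1 (phaseDeriv κ 1 L))) x
      + 6 * (phaseDeriv κ 1 (phaseDeriv κ 1 L) x * phaseDeriv κ 1 (phaseDeriv κ 1 L) x)
      + 3 * phaseDeriv κ 2 (phaseDeriv κ 2 L) x = 0) :
    SolvesKP fun t => 2 * phaseDeriv κ 1 (phaseDeriv κ 1 L) (phase κ t) := by
  have hv : ContDiff ℝ (⊤ : ℕ∞) (phaseDeriv κ 1 (phaseDeriv κ 1 L)) :=
    contDiff_phaseDeriv (contDiff_phaseDeriv hL 1) 1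
  have h0 : ∀ r : ℕ+, phaseDeriv κ r (fun _ => (0 : ℝ)) = fun _ => 0 := fun r => by
    funext x
    simp [phaseDeriv, lineDeriv]
  have hcomm3 : phaseDeriv κ 1 (phaseDeriv κ 1 (phaseDeriv κ 3 L)) =
      phaseDeriv κ 3 (phaseDeriv κ 1 (phaseDeriv κ 1 L)) := by
    rw [phaseDeriv_comm hL 1 3, phaseDeriv_comm (contDiff_phaseDeriv hL 1) 1 3]
  have hcomm2 : phaseDeriv κ 1 (phaseDeriv κ 1 (phaseDeriv κ 2 (phaseDeriv κ 2 L))) =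
      phaseDeriv κ 2 (phaseDeriv κ 2 (phaseDeriv κ 1 (phaseDeriv κ 1 L))) := by
    rw [phaseDeriv_comm (contDiff_phaseDeriv hL 2) 1 2, phaseDeriv_comm hL 1 2,
      phaseDeriv_comm (contDiff_phaseDeriv (contDiff_phaseDeriv hL 1) 2) 1 2,
      phaseDeriv_comm (contDiff_phaseDeriv hL 1) 1 2]
  have h13 := contDiff_phaseDeriv (κ := κ) (contDiff_phaseDeriv (κ := κ) hL 3) 1
  have h22 := contDiff_phaseDeriv (κ := κ) (contDiff_phaseDeriv (κ := κ) hL 2) 2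
  have hv1 := contDiff_phaseDeriv (κ := κ) hv 1
  have hv2 := contDiff_phaseDeriv (κ := κ) hv1 1
  have hv3 := contDiff_phaseDeriv (κ := κ) hv2 1
  have hv_3 := contDiff_phaseDeriv (κ := κ) hv 3
  have h122 := contDiff_phaseDeriv (κ := κ) h22 1
  -- The identity holds at every point, so it may be differentiated twice in x; doubling the result
  -- gives the KP equation for u, since 6 (v²)_xx = 12 (v v_x)_x for v = L_xx.
  have e1 := congrArg (phaseDeriv κ 1) (funext h)
  rw [h0, phaseDeriv_add (((contDiff_const.mul h13).add hv2).add
      (contDiff_const.mul (hv.mul hv))) (contDiff_const.mul h22),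
    phaseDeriv_add ((contDiff_const.mul h13).add hv2) (contDiff_const.mul (hv.mul hv)),
    phaseDeriv_add (contDiff_const.mul h13) hv2, phaseDeriv_const_mul h13,
    phaseDeriv_const_mul (hv.mul hv), phaseDeriv_const_mul h22, phaseDeriv_mul hv hv,
    hcomm3] at e1
  have e2 := congrArg (phaseDeriv κ 1) e1
  rw [h0, phaseDeriv_add (((contDiff_const.mul hv_3).add hv3).add
      (contDiff_const.mul ((hv1.mul hv).add (hv.mul hv1)))) (contDiff_const.mul h122),
    phaseDeriv_const_mul h122, hcomm2] at e2
  intro t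
  simp only [iterate_partialT_phase κ _ (fun x => 2 * phaseDeriv κ 1 (phaseDeriv κ 1 L) x),
    partialT_phase κ _ (fun x => 2 * phaseDeriv κ 1 (phaseDeriv κ 1 L) x),
    Function.iterate_succ_apply, Function.iterate_zero, id_eq]
  have e3 : ∀ r, phaseDeriv κ r (fun x => 2 * phaseDeriv κ 1 (phaseDeriv κ 1 L) x) =
      fun x => 2 * phaseDeriv κ r (phaseDeriv κ 1 (phaseDeriv κ 1 L)) x :=
    fun r => phaseDeriv_const_mul hv 2 r
  simp only [e3]
  rw [phaseDeriv_const_mul hv1, phaseDeriv_const_mul hv2,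
    phaseDeriv_const_mul (contDiff_phaseDeriv hv 2)]
  have e4 := congrFun e2 (phase κ t)
  set G : (Fin M → ℝ) → ℝ := fun x => -4 * phaseDeriv κ 3 (phaseDeriv κ 1 (phaseDeriv κ 1 L)) x +
        phaseDeriv κ 1 (phaseDeriv κ 1 (phaseDeriv κ 1 (phaseDeriv κ 1 (phaseDeriv κ 1 L)))) x +
        6 * (phaseDeriv κ 1 (phaseDeriv κ 1 (phaseDeriv κ 1 L)) x *
          phaseDeriv κ 1 (phaseDeriv κ 1 L) x + phaseDeriv κ 1 (phaseDeriv κ 1 L) x *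
          phaseDeriv κ 1 (phaseDeriv κ 1 (phaseDeriv κ 1 L)) x) with hG
  have e5 : (fun t' => -4 * (2 * phaseDeriv κ 3 (phaseDeriv κ 1 (phaseDeriv κ 1 L)) (phase κ t')) +
        6 * (2 * phaseDeriv κ 1 (phaseDeriv κ 1 L) (phase κ t')) *
          (2 * phaseDeriv κ 1 (phaseDeriv κ 1 (phaseDeriv κ 1 L)) (phase κ t')) +
        2 * phaseDeriv κ 1 (phaseDeriv κ 1 (phaseDeriv κ 1 (phaseDeriv κ 1 (phaseDeriv κ 1 L))))
          (phase κ t')) = fun t' => (fun x => 2 * G x) (phase κ t') := by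
    funext t'
    simp only [hG]
    ring
  rw [e5, partialT_phase κ 1 (fun x => 2 * G x),
    phaseDeriv_const_mul (((contDiff_const.mul hv_3).add hv3).add
      (contDiff_const.mul ((hv1.mul hv).add (hv.mul hv1))))]
  linarith

end Phase

/-! ### The KP soliton of a positive `τ`-function -/

section Wave

variable {N M : ℕ} (κ : Fin M → ℝ) (A : Matrix (Fin N) (Fin M) ℝ)

/-- The matrix `A diag(e^{x_1}, …, e^{x_M}) V`, `V` the Vandermonde matrix; it is the (transposed)
Wronskian matrix of the functions `f_i` at the phases `x`. -/
def waveMat (x : Fin M → ℝ) : Matrix (Fin N) (Fin N) ℝ :=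
  A * Matrix.diagonal (fun j => Real.exp (x j)) * Matrix.rectVandermonde κ 1 N

theorem waveMat_apply (x : Fin M → ℝ) (i a : Fin N) :
    waveMat κ A x i a = ∑ j, A i j * Real.exp (x j) * κ j ^ (a : ℕ) := by
  simp [waveMat, Matrix.mul_apply, Matrix.rectVandermonde_apply,
    Matrix.diagonal_apply]

theorem partialT_sum_exp (r : ℕ+) (b : Fin M → ℝ) (k : ℕ) :
    (partialT r)^[k] (fun t => ∑ j, b j * expFun (κ j) t) =
      fun t => ∑ j, b j * (κ j ^ (r : ℕ)) ^ k * expFun (κ j) t := by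
  induction k generalizing b with
  | zero => simp
  | succ k ih =>
    have h : partialT r (fun t => ∑ j, b j * expFun (κ j) t) =
        fun t => ∑ j, (b j * κ j ^ (r : ℕ)) * expFun (κ j) t := by
      simp only [expFun_eq]
      rw [partialT_phase κ r fun x => ∑ j, b j * Real.exp (x j)]
      funext t
      apply HasLineDerivAt.lineDeriv
      refine HasDerivAt.fun_sum fun j _ => ?_
      have := (((hasDerivAt_id (0 : ℝ)).mul_const (powVec κ r j)).const_add
        (phase κ t j)).exp.const_mul (b j)
      simpa [powVec, mul_comm, mul_assoc, mul_left_comm] using this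
    rw [Function.iterate_succ_apply, h, ih]
    funext t
    exact Finset.sum_congr rfl fun j _ => by ring

theorem iterate_partialT_solF (i : Fin N) (k : ℕ) :
    (partialT 1)^[k] (solF κ A i) = fun t => ∑ j, A i j * κ j ^ k * expFun (κ j) t := by
  have h := partialT_sum_exp κ 1 (A i) k
  simp only [PNat.one_coe, pow_one] at h
  exact h

theorem tau_eq_det (t : Times) : tau κ A t = (waveMat κ A (phase κ t)).det := by
  rw [tau, ← Matrix.det_transpose]
  congr 1
  ext i a
  simp only [Matrix.transpose_apply, Matrix.of_apply, iterate_partialT_solF, waveMat_apply,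
    expFun_eq]
  exact Finset.sum_congr rfl fun j _ => by ring

theorem contDiff_det_waveMat : ContDiff ℝ (⊤ : ℕ∞) fun x => (waveMat κ A x).det := by
  simp only [Matrix.det_apply', waveMat_apply]
  fun_prop

theorem solU_eq (t : Times) : solU κ A t = 2 * phaseDeriv κ 1 (phaseDeriv κ 1
    fun x => Real.log (waveMat κ A x).det) (phase κ t) := by
  simp only [solU, tau_eq_det]
  rw [iterate_partialT_phase κ 1 fun x => Real.log (waveMat κ A x).det]
  rfl

theorem hasMatrixLineDeriv_waveMat_aux (r : ℕ+) :
    HasMatrixLineDeriv (fun x => A * Matrix.diagonal (fun j => Real.exp (x j)))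
      (fun x => A * Matrix.diagonal (fun j => Real.exp (x j)) * Matrix.diagonal κ ^ (r : ℕ))
      (powVec κ r) := by
  intro x i j
  simp only [Matrix.mul_diagonal, Matrix.diagonal_pow]
  have := (((hasDerivAt_id (0 : ℝ)).mul_const (powVec κ r j)).const_add (x j)).exp.const_mul (A i j)
  simpa [HasLineDerivAt, powVec, mul_comm, mul_assoc, mul_left_comm] using this

/-- The idempotent matrix `V (A E V)⁻¹ A E`. -/
def waveProj (x : Fin M → ℝ) : Matrix (Fin M) (Fin M) ℝ :=
  Matrix.rectVandermonde κ 1 N * (waveMat κ A x)⁻¹ * (A * Matrix.diagonal fun j => Real.exp (x j))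

variable {κ A} (hpos : ∀ x, 0 < (waveMat κ A x).det)

include hpos

theorem waveProj_mul_vandermonde (x : Fin M → ℝ) :
    waveProj κ A x * Matrix.rectVandermonde κ 1 N = Matrix.rectVandermonde κ 1 N := by
  rw [waveProj, Matrix.mul_assoc _ (A * _), ← waveMat, Matrix.mul_assoc,
    Matrix.nonsing_inv_mul _ (hpos x).ne'.isUnit, Matrix.mul_one]

theorem waveProj_idem (x : Fin M → ℝ) : waveProj κ A x * waveProj κ A x = waveProj κ A x := by
  have h : waveProj κ A x = Matrix.rectVandermonde κ 1 N *
      ((waveMat κ A x)⁻¹ * (A * Matrix.diagonal fun j => Real.exp (x j))) := by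
    rw [waveProj, Matrix.mul_assoc]
  calc _ = waveProj κ A x * (Matrix.rectVandermonde κ 1 N *
      ((waveMat κ A x)⁻¹ * (A * Matrix.diagonal fun j => Real.exp (x j)))) := by rw [← h]
    _ = _ := by rw [← Matrix.mul_assoc, waveProj_mul_vandermonde hpos, ← h]

/-- Only A E depends on the phases, and ∂_r(A E) = A E D^r. The outer factor contributes Q D^r, the
inverse contributes -Q D^r Q. -/
theorem hasMatrixLineDeriv_waveProj (r : ℕ+) :
    HasMatrixLineDeriv (waveProj κ A)
      (fun x => waveProj κ A x * Matrix.diagonal κ ^ (r : ℕ) * (1 - waveProj κ A x))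
      (powVec κ r) := by
  have h1 := hasMatrixLineDeriv_waveMat_aux κ A r
  have h2 : HasMatrixLineDeriv (waveMat κ A) _ _ := h1.mul (.const (Matrix.rectVandermonde κ 1 N))
  have h3 := ((HasMatrixLineDeriv.const (Matrix.rectVandermonde κ 1 N)).mul
    (h2.inv fun x => (hpos x).ne')).mul h1
  refine HasMatrixLineDeriv.congr h3 fun x => ?_
  simp only [waveProj, Matrix.zero_mul, Matrix.mul_zero, zero_add, add_zero, Matrix.mul_sub,
    Matrix.mul_neg, Matrix.neg_mul, Matrix.mul_one, Matrix.mul_assoc]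
  abel

theorem hasLineDerivAt_log_det_waveMat (r : ℕ+) (x : Fin M → ℝ) :
    HasLineDerivAt ℝ (fun x => Real.log (waveMat κ A x).det)
      (waveProj κ A x * Matrix.diagonal κ ^ (r : ℕ)).trace x (powVec κ r) := by
  have h1 := hasMatrixLineDeriv_waveMat_aux κ A r
  have h2 : HasMatrixLineDeriv (waveMat κ A) _ _ := h1.mul (.const (Matrix.rectVandermonde κ 1 N))
  have h3 := (h2.det x).log (by simpa using (hpos x).ne')
  have e : (waveProj κ A x * Matrix.diagonal κ ^ (r : ℕ)).trace =
      ((waveMat κ A x).adjugate * (A * Matrix.diagonal (fun j => Real.exp (x j)) *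
        Matrix.diagonal κ ^ (r : ℕ) * Matrix.rectVandermonde κ 1 N
          + A * Matrix.diagonal (fun j => Real.exp (x j)) *
            (0 : Matrix (Fin M) (Fin N) ℝ))).trace
        / (waveMat κ A (x + (0 : ℝ) • powVec κ r)).det := by
    rw [zero_smul, add_zero, Matrix.mul_zero, add_zero, waveProj, Matrix.mul_assoc,
      Matrix.mul_assoc, Matrix.trace_mul_comm, Matrix.inv_def, Ring.inverse_eq_inv',
      Matrix.smul_mul, Matrix.smul_mul, Matrix.trace_smul, smul_eq_mul, inv_mul_eq_div]
    simp only [Matrix.mul_assoc]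
  rw [e]
  exact h3

/-- D sends the Vandermonde column κ^a to κ^(a+1), so it preserves the range of V except for the
last column. Since 1 - Q annihilates that range, only the last column survives. -/
theorem exists_waveProj_rank_one (x : Fin M → ℝ) :
    ∃ v w, (1 - waveProj κ A x) * Matrix.diagonal κ * waveProj κ A x = Matrix.vecMulVec v w := by
  rcases N with _ | n
  · refine ⟨0, 0, ?_⟩
    have : waveProj κ A x = 0 := by
      ext i j
      simp [waveProj, Matrix.mul_apply]
    simp [this]
  · set V := Matrix.rectVandermonde κ 1 (n + 1) with hV
    set G := (waveMat κ A x)⁻¹ * (A * Matrix.diagonal fun j => Real.exp (x j)) with hG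
    have hQ : waveProj κ A x = V * G := by rw [waveProj, Matrix.mul_assoc]
    have h0 : (1 - waveProj κ A x) * V = 0 := by
      rw [Matrix.sub_mul, Matrix.one_mul, waveProj_mul_vandermonde hpos, sub_self]
    have hcol : ∀ i (a : Fin n),
        ((1 - waveProj κ A x) * (Matrix.diagonal κ * V) : Matrix _ (Fin (n + 1)) ℝ)
          i a.castSucc = 0 := by
      intro i a
      have : ∀ k, (Matrix.diagonal κ * V) k a.castSucc = V k a.succ := by
        intro k
        simp [hV, Matrix.diagonal_mul, Matrix.rectVandermonde_apply, pow_succ, mul_comm]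
      rw [Matrix.mul_apply, Finset.sum_congr rfl fun k _ => by rw [this k], ← Matrix.mul_apply, h0]
      rfl
    refine ⟨fun i =>
      ((1 - waveProj κ A x) * (Matrix.diagonal κ * V) : Matrix _ (Fin (n + 1)) ℝ) i (Fin.last n),
      G (Fin.last n), ?_⟩
    have : (1 - waveProj κ A x) * Matrix.diagonal κ * waveProj κ A x =
        ((1 - waveProj κ A x) * (Matrix.diagonal κ * V)) * G := by
      simp only [Matrix.mul_assoc]
      rw [← hQ]
    rw [this]
    ext i j
    rw [Matrix.mul_apply, Fin.sum_univ_castSucc]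
    simp [hcol, Matrix.vecMulVec_apply]

/-- The derivation rule for Q makes each derivative of L the trace of a word in Q, 1 - Q and D; the
combination is then the one in `trace_hirota`. -/
theorem hirota_log_det_waveMat {L : (Fin M → ℝ) → ℝ}
    (hdef : L = fun x => Real.log (waveMat κ A x).det) (x : Fin M → ℝ) :
    -4 * phaseDeriv κ 1 (phaseDeriv κ 3 L) x
      + phaseDeriv κ 1 (phaseDeriv κ 1 (phaseDeriv κ 1 (phaseDeriv κ 1 L))) x
      + 6 * (phaseDeriv κ 1 (phaseDeriv κ 1 L) x * phaseDeriv κ 1 (phaseDeriv κ 1 L) x)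
      + 3 * phaseDeriv κ 2 (phaseDeriv κ 2 L) x = 0 := by
  set D := Matrix.diagonal κ with hD
  have hL : ∀ r : ℕ+, phaseDeriv κ r L = fun x => (waveProj κ A x * D ^ (r : ℕ)).trace :=
    fun r => hdef ▸ funext fun x => (hasLineDerivAt_log_det_waveMat hpos r x).lineDeriv
  have hQ := hasMatrixLineDeriv_waveProj hpos
  have hLL : ∀ r s : ℕ+, phaseDeriv κ s (phaseDeriv κ r L) = fun x =>
      (waveProj κ A x * D ^ (s : ℕ) * (1 - waveProj κ A x) * D ^ (r : ℕ)).trace := by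
    intro r s
    rw [hL]
    funext x
    refine HasLineDerivAt.lineDeriv ?_
    have := ((hQ s).mul (.const (D ^ (r : ℕ)))).trace x
    simpa using this
  have hQ1 : HasMatrixLineDeriv (waveProj κ A)
      (fun x => waveProj κ A x * D * (1 - waveProj κ A x)) (powVec κ 1) :=
    (hQ 1).congr fun x => by simp [hD]
  have hP1 : HasMatrixLineDeriv (fun x => 1 - waveProj κ A x)
      (fun x => -(waveProj κ A x * D * (1 - waveProj κ A x))) (powVec κ 1) :=
    ((HasMatrixLineDeriv.const 1).sub hQ1).congr fun x => by simp
  have hQD : HasMatrixLineDeriv (fun x => waveProj κ A x * D)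
      (fun x => waveProj κ A x * D * (1 - waveProj κ A x) * D) (powVec κ 1) :=
    (hQ1.mul (.const D)).congr fun x => by simp
  have hPD : HasMatrixLineDeriv (fun x => (1 - waveProj κ A x) * D)
      (fun x => -(waveProj κ A x * D * (1 - waveProj κ A x) * D)) (powVec κ 1) :=
    (hP1.mul (.const D)).congr fun x => by simp
  have h3 : phaseDeriv κ 1 (phaseDeriv κ 1 (phaseDeriv κ 1 L)) = fun x =>
      (waveProj κ A x * D * ((1 - waveProj κ A x) * D) * ((1 - waveProj κ A x) * D)
        - waveProj κ A x * D * (waveProj κ A x * D) * ((1 - waveProj κ A x) * D)).trace := by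
    rw [hLL]
    funext x
    refine HasLineDerivAt.lineDeriv ?_
    have := (hQD.mul hPD).trace x
    convert this using 2
    · simp [Matrix.mul_assoc]
    · noncomm_ring
  have h4 := ((((hQD.mul hPD).mul hPD).sub ((hQD.mul hQD).mul hPD)).trace x).lineDeriv
  replace h4 := (congrArg (fun f => lineDeriv ℝ f x (powVec κ 1)) h3).trans h4
  change phaseDeriv κ 1 (phaseDeriv κ 1 (phaseDeriv κ 1 (phaseDeriv κ 1 L))) x = _ at h4
  obtain ⟨v, w, hvw⟩ := exists_waveProj_rank_one hpos x
  have key := trace_hirota (waveProj κ A x) D (1 - waveProj κ A x) (waveProj_idem hpos x) rfl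
    v w hvw
  have hLs : ContDiff ℝ (⊤ : ℕ∞) L :=
    hdef ▸ (contDiff_det_waveMat κ A).log fun x => (hpos x).ne'
  rw [phaseDeriv_comm hLs 1 3, h4, hLL, hLL, hLL, ← key, ← Matrix.trace_sub]
  beta_reduce
  generalize 1 - waveProj κ A x = P
  generalize waveProj κ A x = Q
  simp only [PNat.val_ofNat, pow_one, ← sq]
  congr 4
  noncomm_ring

/-- A positive `τ`-function gives a regular KP soliton. -/
theorem isKPSoliton_of_det_pos (hκ : StrictMono κ) : IsKPSoliton κ A := by
  have hL : ContDiff ℝ (⊤ : ℕ∞) fun x => Real.log (waveMat κ A x).det :=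
    (contDiff_det_waveMat κ A).log fun x => (hpos x).ne'
  have hU : solU κ A = fun t => 2 * phaseDeriv κ 1 (phaseDeriv κ 1
      fun x => Real.log (waveMat κ A x).det) (phase κ t) := funext (solU_eq κ A)
  refine ⟨hκ, fun t => tau_eq_det κ A t ▸ hpos _, ?_, ?_⟩
  · rw [hU]
    exact smoothInTimes_phase
      (contDiff_const.mul (contDiff_phaseDeriv (contDiff_phaseDeriv hL 1) 1))
  · rw [hU]
    exact solvesKP_of_hirota hL (hirota_log_det_waveMat hpos rfl)

end Wave

/-! ### Positivity of the `τ`-function -/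

section Positivity

variable {N M : ℕ}

/-- A symmetrized form of the Cauchy–Binet formula. -/
theorem factorial_mul_det_mul {R : Type*} [CommRing R] (A : Matrix (Fin N) (Fin M) R)
    (B : Matrix (Fin M) (Fin N) R) :
    (N.factorial : R) * (A * B).det =
      ∑ f : Fin N → Fin M, (A.submatrix id f).det * (B.submatrix f id).det := by
  have h1 : (A * B).det = ∑ f : Fin N → Fin M, (∏ i, A i (f i)) * (B.submatrix f id).det := by
    have : A * B = fun i => ∑ j, A i j • B j := by
      ext i k
      simp [Matrix.mul_apply]
    rw [this]
    change Matrix.detRowAlternating.toMultilinearMap _ = _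
    rw [MultilinearMap.map_sum]
    refine Finset.sum_congr rfl fun f _ => ?_
    rw [MultilinearMap.map_smul_univ]
    rfl
  -- Reindexing f by σ changes the minor of B by sign σ. Summing the resulting N! expressions for
  -- the same determinant assembles the determinants of A as well.
  have h2 : ∀ σ : Equiv.Perm (Fin N), ∑ f : Fin N → Fin M,
      ((Equiv.Perm.sign σ : ℤ) : R) * (∏ i, A (σ i) (f i)) * (B.submatrix f id).det
      = (A * B).det := by
    intro σ
    rw [h1]
    refine Fintype.sum_equiv (Equiv.arrowCongr σ (Equiv.refl (Fin M))) _ _ fun f => ?_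
    have e1 : ∏ i, A i (f (σ.symm i)) = ∏ i, A (σ i) (f i) := by
      rw [← Equiv.prod_comp σ]
      simp
    have e2 : (B.submatrix (fun i => f (σ.symm i)) id).det =
        ((Equiv.Perm.sign σ : ℤ) : R) * (B.submatrix f id).det := by
      have := Matrix.det_permute σ.symm (B.submatrix f id)
      rw [Equiv.Perm.sign_symm] at this
      exact this
    change _ = (∏ i, A i (f (σ.symm i))) * (B.submatrix (fun i => f (σ.symm i)) id).det
    rw [e1, e2]
    ring
  calc _ = ∑ _σ : Equiv.Perm (Fin N), (A * B).det := by
        simp [Fintype.card_perm]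
    _ = _ := by
        rw [Finset.sum_congr rfl fun σ _ => (h2 σ).symm, Finset.sum_comm]
        refine Finset.sum_congr rfl fun f _ => ?_
        rw [← Finset.sum_mul, Matrix.det_apply' (A.submatrix id f)]
        rfl

theorem det_rectVandermonde_pos {κ : Fin M → ℝ} (hκ : StrictMono κ) (I : Fin N ↪o Fin M) :
    0 < ((Matrix.rectVandermonde κ 1 N).submatrix I id).det := by
  have : (Matrix.rectVandermonde κ 1 N).submatrix I id = Matrix.vandermonde (κ ∘ I) := by
    ext i j
    simp [Matrix.rectVandermonde_apply, Matrix.vandermonde_apply]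
  rw [this, Matrix.det_vandermonde]
  refine Finset.prod_pos fun i _ => Finset.prod_pos fun j hj => sub_pos.2 (hκ ?_)
  exact I.strictMono (Finset.mem_Ioi.1 hj)

/-- The pivot columns of a matrix in reduced row echelon form. -/
def pivotEmb {A : Matrix (Fin N) (Fin M) ℝ} (hA : IsRREF A) : Fin N ↪o Fin M :=
  OrderEmbedding.ofStrictMono hA.choose hA.choose_spec.1

section Pivot

variable {A : Matrix (Fin N) (Fin M) ℝ} (hA : IsRREF A)

theorem apply_eq_zero_of_lt_pivotEmb {i : Fin N} {j : Fin M} (h : j < pivotEmb hA i) : A i j = 0 :=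
  hA.choose_spec.2.1 i j h

theorem apply_pivotEmb (i i' : Fin N) : A i' (pivotEmb hA i) = if i' = i then 1 else 0 :=
  hA.choose_spec.2.2 i i'

theorem submatrix_pivotEmb : A.submatrix id (pivotEmb hA) = 1 := by
  ext i j
  simp [apply_pivotEmb, Matrix.one_apply]

theorem maxMinor_pivotEmb : maxMinor A (pivotEmb hA) = 1 := by
  rw [maxMinor, submatrix_pivotEmb, Matrix.det_one]

end Pivot

/-- In the symmetrized Cauchy–Binet sum a non-injective f contributes zero. Sorting an injective f
changes both determinants by the same sign, so its term is nonnegative. The pivot columns give a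
strictly positive term. -/
theorem det_waveMat_pos {κ : Fin M → ℝ} (hκ : StrictMono κ) {A : Matrix (Fin N) (Fin M) ℝ}
    (hA : IsTNN A) (x : Fin M → ℝ) : 0 < (waveMat κ A x).det := by
  set B := Matrix.diagonal (fun j => Real.exp (x j)) * Matrix.rectVandermonde κ 1 N with hB
  have hBpos : ∀ I : Fin N ↪o Fin M, 0 < (B.submatrix I id).det := by
    intro I
    have : B.submatrix I id = Matrix.of fun i j =>
        Real.exp (x (I i)) * ((Matrix.rectVandermonde κ 1 N).submatrix I id) i j := by
      ext i j
      simp [hB, Matrix.diagonal_mul]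
    rw [this, Matrix.det_mul_column]
    exact mul_pos (Finset.prod_pos fun i _ => Real.exp_pos _) (det_rectVandermonde_pos hκ I)
  have hnn : ∀ I : Fin N ↪o Fin M, 0 ≤ (A.submatrix id I).det := by
    intro I
    by_cases h : I ∈ matroid A
    · exact (hA.2 I h).le
    · rw [matroid, Set.mem_ofPred_eq, not_not] at h
      exact h.ge
  have hterm : ∀ f : Fin N → Fin M, 0 ≤ (A.submatrix id f).det * (B.submatrix f id).det := by
    intro f
    by_cases hf : Function.Injective f
    · set σ := Tuple.sort f
      have hmono : StrictMono (f ∘ σ) :=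
        (Tuple.monotone_sort f).strictMono_of_injective (hf.comp σ.injective)
      set I := OrderEmbedding.ofStrictMono _ hmono
      have h1 := Matrix.det_permute' σ (A.submatrix id f)
      have h2 := Matrix.det_permute σ (B.submatrix f id)
      have h3 := mul_nonneg (hnn I) (hBpos I).le
      change 0 ≤ ((A.submatrix id f).submatrix id σ).det * ((B.submatrix f id).submatrix σ id).det
        at h3
      rw [h1, h2] at h3
      rcases Int.units_eq_one_or (Equiv.Perm.sign σ) with h | h <;> simpa [h] using h3
    · obtain ⟨i, j, hij, hne⟩ : ∃ i j, f i = f j ∧ i ≠ j := by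
        simpa [Function.Injective, and_comm] using hf
      rw [Matrix.det_zero_of_column_eq hne (fun k => by simp [hij]), zero_mul]
  have hpos : 0 < ∑ f : Fin N → Fin M, (A.submatrix id f).det * (B.submatrix f id).det := by
    refine Finset.sum_pos' (fun f _ => hterm f) ⟨pivotEmb hA.1, Finset.mem_univ _, ?_⟩
    have := maxMinor_pivotEmb hA.1
    rw [maxMinor] at this
    rw [this, one_mul]
    exact hBpos _
  rw [← factorial_mul_det_mul, hB, ← Matrix.mul_assoc, ← waveMat] at hpos
  exact pos_of_mul_pos_right hpos (Nat.cast_nonneg _)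

end Positivity

/-! ### The `ℓ`-reduction -/

section Reduction

variable {N M : ℕ} {κ : Fin M → ℝ} {A : Matrix (Fin N) (Fin M) ℝ}

theorem phaseDeriv_comp_add (r : ℕ+) (f : (Fin M → ℝ) → ℝ) (v : Fin M → ℝ) :
    phaseDeriv κ r (fun x => f (x + v)) = fun x => phaseDeriv κ r f (x + v) := by
  funext x
  simp only [phaseDeriv, lineDeriv, add_right_comm]

theorem phaseDeriv_const_add (r : ℕ+) (f : (Fin M → ℝ) → ℝ) (c : ℝ) :
    phaseDeriv κ r (fun x => c + f x) = phaseDeriv κ r f := by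
  funext x
  simp [phaseDeriv, lineDeriv]

/-- If the parameters `κ_j` in the support of the row `i` lie on the curve `φ_ℓ(κ) = a_i`, then the
soliton satisfies the `ℓ`-reduction. -/
theorem isReduced_of_support (ℓ : ℕ+) (c : ℕ+ → ℝ) (a : Fin N → ℝ)
    (h : ∀ i j, A i j ≠ 0 →
      κ j ^ (ℓ : ℕ) - ∑ r ∈ Finset.Ico 1 ℓ, c r * κ j ^ (r : ℕ) = a i)
    (hpos : ∀ x, 0 < (waveMat κ A x).det) : IsReduced ℓ c a κ A := by
  constructor
  · intro i t
    simp only [iterate_partialT_solF, solF, Finset.mul_sum]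
    rw [Finset.sum_comm, ← Finset.sum_sub_distrib]
    refine Finset.sum_congr rfl fun j _ => ?_
    by_cases hij : A i j = 0
    · simp [hij]
    · rw [← h i j hij, sub_mul, Finset.sum_mul]
      congr 1
      · ring
      · exact Finset.sum_congr rfl fun r _ => by ring
  · intro t s
    set q : Fin M → ℝ := fun j => κ j ^ (ℓ : ℕ) - ∑ r ∈ Finset.Ico 1 ℓ, c r * κ j ^ (r : ℕ) with hq
    have hphase : phase κ (Finsupp.single ℓ s - ∑ r ∈ Finset.Ico 1 ℓ, Finsupp.single r (c r * s))
        = s • q := by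
      funext j
      simp only [map_sub, map_sum, phase_single, Pi.sub_apply, Finset.sum_apply, Pi.smul_apply,
        smul_eq_mul, powVec, hq, mul_sub, Finset.mul_sum]
      congr 1
      exact Finset.sum_congr rfl fun r _ => by ring
    -- The shift multiplies row i by exp(s a_i), because q equals a_i on the support of that row; so
    -- ln τ changes only by a constant.
    have hdet : ∀ x, (waveMat κ A (x + s • q)).det =
        (∏ i, Real.exp (s * a i)) * (waveMat κ A x).det := by
      intro x
      rw [← Matrix.det_mul_column]
      congr 1
      ext i b
      simp only [waveMat_apply, Matrix.of_apply, Finset.mul_sum]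
      refine Finset.sum_congr rfl fun j _ => ?_
      by_cases hij : A i j = 0
      · simp [hij]
      · rw [← h i j hij, Pi.add_apply, Real.exp_add]
        simp only [Pi.smul_apply, smul_eq_mul, hq]
        ring
    have hlog : (fun x => Real.log (waveMat κ A (x + s • q)).det) = fun x =>
        Real.log (∏ i, Real.exp (s * a i)) + Real.log (waveMat κ A x).det := by
      funext x
      rw [hdet, Real.log_mul (Finset.prod_pos fun i _ => Real.exp_pos _).ne' (hpos x).ne']
    rw [solU_eq, solU_eq, map_add, hphase]
    congr 1
    set L := fun x => Real.log (waveMat κ A x).det with hL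
    have h1 := congrArg (phaseDeriv κ 1) hlog
    rw [phaseDeriv_const_add, phaseDeriv_comp_add 1 L] at h1
    have h2 := congrArg (phaseDeriv κ 1) h1
    rw [phaseDeriv_comp_add 1 (phaseDeriv κ 1 L)] at h2
    exact congrFun h2 (phase κ t)

end Reduction

/-! ### Non-crossing permutations -/

section NonCrossing

variable {M : ℕ}

theorem NonCrossing.symm {σ ρ : Equiv.Perm (Fin M)} (h : NonCrossing σ ρ) : NonCrossing ρ σ :=
  ⟨fun i j hi hj hc => h.1 j i hj hi (Or.symm hc), fun i j hi hj hc => h.2 j i hj hi (Or.symm hc)⟩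

theorem cycleOf_apply_eq_of_ne {σ : Equiv.Perm (Fin M)} {s i : Fin M} (h : σ.cycleOf s i ≠ i) :
    σ.SameCycle s i ∧ σ.cycleOf s i = σ i := by
  rw [Equiv.Perm.cycleOf_apply] at h ⊢
  split_ifs with hs
  · exact ⟨hs, rfl⟩
  · simp [hs] at h

theorem NonCrossing.cycleOf_left {σ ρ : Equiv.Perm (Fin M)} (h : NonCrossing σ ρ) (s : Fin M) :
    NonCrossing (σ.cycleOf s) ρ := by
  constructor
  · intro i j hi hj
    have e := (cycleOf_apply_eq_of_ne hi.ne').2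
    rw [e] at hi ⊢
    exact h.1 i j hi hj
  · intro i j hi hj
    have e := (cycleOf_apply_eq_of_ne hi.ne).2
    rw [e] at hi ⊢
    exact h.2 i j hi hj

/-- The number of chords of `σ` above the line that pass over `x`. -/
def overCount (σ : Equiv.Perm (Fin M)) (x : Fin M) : ℕ :=
  (Finset.univ.filter fun i => i < x ∧ x < σ i).card

/-- As many chords pass over a fixed point as below it. -/
theorem overCount_eq_under {σ : Equiv.Perm (Fin M)} {x : Fin M} (hx : σ x = x) :
    overCount σ x = (Finset.univ.filter fun i => σ i < x ∧ x < i).card := by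
  have hne : ∀ i, σ i = x → i = x := fun i hi => σ.injective (hi.trans hx.symm)
  have h1 : (Finset.univ.filter fun i => i < x).card =
      (Finset.univ.filter fun i => σ i < x).card := by
    symm
    exact Finset.card_bij (fun i _ => σ i) (by simp) (fun _ _ _ _ h => σ.injective h)
      fun b hb => ⟨σ.symm b, by simpa using hb, by simp⟩
  have h2 : (Finset.univ.filter fun i => i < x).card =
      overCount σ x + (Finset.univ.filter fun i => i < x ∧ σ i < x).card := by
    rw [overCount, ← Finset.card_union_of_disjoint]
    · congr 1
      ext i
      have := hne i
      simp only [Finset.mem_filter, Finset.mem_univ, true_and, Finset.mem_union]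
      grind
    · rw [Finset.disjoint_filter]
      grind
  have h3 : (Finset.univ.filter fun i => σ i < x).card =
      (Finset.univ.filter fun i => σ i < x ∧ x < i).card +
        (Finset.univ.filter fun i => i < x ∧ σ i < x).card := by
    rw [← Finset.card_union_of_disjoint]
    · congr 1
      ext i
      simp only [Finset.mem_filter, Finset.mem_univ, true_and, Finset.mem_union]
      grind
    · rw [Finset.disjoint_filter]
      grind
  omega

/-- If t < ρ t, an upper chord of σ over exactly one end of [t, ρ t] would cross it. If ρ t < t, the
same argument applies to the lower chords, which are equally many by `overCount_eq_under`. -/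
theorem overCount_apply {σ ρ : Equiv.Perm (Fin M)} (h : NonCrossing σ ρ) {t : Fin M}
    (ht : σ t = t) (ht' : σ (ρ t) = ρ t) : overCount σ (ρ t) = overCount σ t := by
  have hne : ∀ i, σ i = t → i = t := fun i hi => σ.injective (hi.trans ht.symm)
  have hne' : ∀ i, σ i = ρ t → i = ρ t := fun i hi => σ.injective (hi.trans ht'.symm)
  rcases lt_trichotomy t (ρ t) with hlt | heq | hlt
  · rw [overCount, overCount]
    congr 1
    ext i
    have h1 := h.1 i t
    have h2 := hne i
    have h3 := hne' i
    simp only [ChordsCross] at h1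
    simp only [Finset.mem_filter, Finset.mem_univ, true_and]
    grind
  · rw [← heq]
  · rw [overCount_eq_under ht, overCount_eq_under ht']
    congr 1
    ext i
    have h1 := h.2 i t
    have h2 := hne i
    have h3 := hne' i
    simp only [ChordsCross] at h1
    simp only [Finset.mem_filter, Finset.mem_univ, true_and]
    grind

theorem overCount_sameCycle {σ ρ : Equiv.Perm (Fin M)} (h : NonCrossing σ ρ)
    (hd : σ.Disjoint ρ) {t t' : Fin M} (ht : σ t = t) (hs : ρ.SameCycle t t') :
    σ t' = t' ∧ overCount σ t' = overCount σ t := by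
  obtain ⟨n, rfl⟩ := hs.exists_nat_pow_eq
  clear hs
  induction n with
  | zero => exact ⟨ht, rfl⟩
  | succ n ih =>
    have hfix : σ (ρ ((ρ ^ n) t)) = ρ ((ρ ^ n) t) := by
      rcases hd (ρ ((ρ ^ n) t)) with h' | h'
      · exact h'
      · rw [ρ.injective h']
        exact ih.1
    rw [pow_succ', Equiv.Perm.mul_apply]
    exact ⟨hfix, (overCount_apply h ih.1 hfix).trans ih.2⟩

/-- An orbit can pass from the left to the right of a fixed point only along a chord over it. -/
theorem lt_of_overCount_eq_zero {σ : Equiv.Perm (Fin M)} {t : Fin M} (ht : σ t = t)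
    (h0 : overCount σ t = 0) {i j : Fin M} (hij : σ.SameCycle i j) (hi : i < t) : j < t := by
  obtain ⟨n, rfl⟩ := hij.exists_nat_pow_eq
  clear hij
  induction n with
  | zero => exact hi
  | succ n ih =>
    rw [pow_succ', Equiv.Perm.mul_apply]
    by_contra hlt
    rcases (not_lt.1 hlt).eq_or_lt with heq | hlt'
    · exact ih.ne (σ.injective (heq.symm.trans ht.symm))
    · rw [overCount, Finset.card_eq_zero, Finset.filter_eq_empty_iff] at h0
      exact h0 (Finset.mem_univ _) ⟨ih, hlt'⟩

/-- The count of chords of one σ-cycle is constant along a ρ-cycle; if it vanishes once, no point of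
the ρ-cycle separates the σ-cycle. -/
theorem cycle_same_side {σ ρ : Equiv.Perm (Fin M)} (h : NonCrossing σ ρ) (hd : σ.Disjoint ρ)
    {s t t₁ : Fin M} (ht : ρ t ≠ t) (ht₁ : ρ.SameCycle t t₁)
    (h0 : overCount (σ.cycleOf s) t₁ = 0) {t' i : Fin M} (ht' : ρ.SameCycle t t')
    (hi : σ.SameCycle s i) : i < t' ↔ s < t' := by
  have hd' : (σ.cycleOf s).Disjoint ρ := fun x => by
    by_cases hx : σ.cycleOf s x = x
    · exact Or.inl hx
    · refine Or.inr ((hd x).resolve_left fun h' => hx ?_)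
      rw [(cycleOf_apply_eq_of_ne hx).2, h']
  have hfix : σ.cycleOf s t = t := (hd' t).resolve_right ht
  have h1 := overCount_sameCycle (h.cycleOf_left s) hd' hfix ht'
  have h2 := overCount_sameCycle (h.cycleOf_left s) hd' hfix ht₁
  have h3 : overCount (σ.cycleOf s) t' = 0 := by rw [h1.2, ← h2.2, h0]
  have hc : (σ.cycleOf s).SameCycle s i := by
    obtain ⟨n, rfl⟩ := hi.exists_nat_pow_eq
    exact ⟨n, by simp⟩
  exact ⟨lt_of_overCount_eq_zero h1.1 h3 hc.symm, lt_of_overCount_eq_zero h1.1 h3 hc⟩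

/-- The cycles of two non-crossing disjoint permutations are non-crossing: one of them lies in a
gap of the other. -/
theorem cycles_noncrossing {σ ρ : Equiv.Perm (Fin M)} (h : NonCrossing σ ρ) (hd : σ.Disjoint ρ)
    {s t : Fin M} (hs : σ s ≠ s) (ht : ρ t ≠ t) :
    (∀ t' i, ρ.SameCycle t t' → σ.SameCycle s i → (i < t' ↔ s < t')) ∨
      ∀ t' i, ρ.SameCycle t t' → σ.SameCycle s i → (i < t' ↔ i < t) := by
  by_cases h0 : ∃ t₁, ρ.SameCycle t t₁ ∧ overCount (σ.cycleOf s) t₁ = 0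
  · obtain ⟨t₁, ht₁, h0⟩ := h0
    exact Or.inl fun t' i ht' hi => cycle_same_side h hd ht ht₁ h0 ht' hi
  · right
    classical
    -- A σ-chord over the leftmost point t₀ of the ρ-cycle starts at some i₀ to the left of that
    -- whole cycle. No chord of the ρ-cycle passes over i₀, so `cycle_same_side` applies with the
    -- roles exchanged.
    obtain ⟨t₀, ht₀, hmin⟩ := (Finset.univ.filter fun y => ρ.SameCycle t y).exists_min_image id
      ⟨t, Finset.mem_filter.2 ⟨Finset.mem_univ _, Equiv.Perm.SameCycle.refl _ _⟩⟩
    simp only [Finset.mem_filter, Finset.mem_univ, true_and, id_eq] at ht₀ hmin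
    have hne : overCount (σ.cycleOf s) t₀ ≠ 0 := fun h' => h0 ⟨t₀, ht₀, h'⟩
    rw [overCount, Finset.card_ne_zero] at hne
    obtain ⟨i₀, hi₀⟩ := hne
    simp only [Finset.mem_filter, Finset.mem_univ, true_and] at hi₀
    have hi₀' := (cycleOf_apply_eq_of_ne (hi₀.1.trans hi₀.2).ne').1
    have hz : overCount (ρ.cycleOf t) i₀ = 0 := by
      rw [overCount, Finset.card_eq_zero, Finset.filter_eq_empty_iff]
      rintro y - ⟨hy1, hy2⟩
      have := hmin y (cycleOf_apply_eq_of_ne (hy1.trans hy2).ne').1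
      exact (lt_irrefl _ (this.trans_lt (hy1.trans hi₀.1)))
    intro t' i ht' hi
    have key := cycle_same_side h.symm hd.symm hs hi₀' hz hi ht'
    have hne : ∀ y, ρ.SameCycle t y → y ≠ i := by
      rintro y hy rfl
      have h1 : σ y ≠ y := fun h' => hs (((hi.apply_eq_self_iff).2 h'))
      have h2 : ρ y ≠ y := fun h' => ht (((hy.apply_eq_self_iff).2 h'))
      exact (hd y).elim h1 h2
    have h1 := hne t' ht'
    have h2 := hne t (Equiv.Perm.SameCycle.refl _ _)
    grind

/-! ### Gap classes and weighted sums over them -/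

/-- The columns between `t` and `t'` are invariant under `σ`. -/
def GapEquiv (σ : Equiv.Perm (Fin M)) (t t' : Fin M) : Prop :=
  ∀ i, (i < t ↔ i < t') ↔ (σ i < t ↔ σ i < t')

theorem gapEquiv_equivalence (σ : Equiv.Perm (Fin M)) : Equivalence (GapEquiv σ) where
  refl _ _ := by simp
  symm h i := by rw [iff_comm (a := i < _), iff_comm (a := σ i < _)]; exact h i
  trans h h' i := by
    have h1 := h i
    have h2 := h' i
    grind

/-- The half-open interval [b, c) is the intersection of the invariant intervals [a, c) and [b, d).
-/
theorem GapEquiv.of_crossing {σ : Equiv.Perm (Fin M)} {a b c d : Fin M} (hab : a < b)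
    (hbc : b < c) (hcd : c < d) (hac : GapEquiv σ a c) (hbd : GapEquiv σ b d) :
    GapEquiv σ a b := by
  have h : GapEquiv σ b c := by
    intro i
    have h1 := hac i
    have h2 := hbd i
    grind
  exact (gapEquiv_equivalence σ).trans hac ((gapEquiv_equivalence σ).symm h)

/-- In one case of `cycles_noncrossing` neither t nor ρ t separates the σ-cycle of i; in the other,
t and ρ t lie on the same side of each of its points. -/
theorem NonCrossing.gapEquiv {σ ρ : Equiv.Perm (Fin M)} (h : NonCrossing σ ρ)
    (hd : σ.Disjoint ρ) (t : Fin M) : GapEquiv σ t (ρ t) := by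
  intro i
  by_cases hi : σ i = i
  · rw [hi]
  by_cases ht : ρ t = t
  · simp [ht]
  have ht' : ρ.SameCycle t (ρ t) :=
    Equiv.Perm.sameCycle_apply_right.2 (Equiv.Perm.SameCycle.refl _ _)
  have hi' : σ.SameCycle i (σ i) :=
    Equiv.Perm.sameCycle_apply_right.2 (Equiv.Perm.SameCycle.refl _ _)
  rcases cycles_noncrossing h hd hi ht with h' | h'
  · rw [h' t (σ i) (Equiv.Perm.SameCycle.refl _ _) hi', h' (ρ t) (σ i) ht' hi']
  · have h1 := h' (ρ t) (σ i) ht' hi'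
    have h2 := h' (ρ t) i ht' (Equiv.Perm.SameCycle.refl _ _)
    rw [h1, h2]
    simp

open Classical in
theorem sum_mul_eq_zero_of_classes {ι : Type*} {r : ι → ι → Prop} (hr : Equivalence r)
    (U : Finset ι) (f h : ι → ℤ) (hf : ∀ x ∈ U, ∑ y ∈ U with r x y, f y = 0)
    (hh : ∀ x ∈ U, ∀ y ∈ U, r x y → h x = h y) : ∑ x ∈ U, f x * h x = 0 := by
  rw [← Finset.sum_fiberwise_of_maps_to (g := fun x => U.filter (r x))
    (t := U.image fun x => U.filter (r x)) fun x hx => Finset.mem_image_of_mem _ hx]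
  refine Finset.sum_eq_zero fun Z hZ => ?_
  obtain ⟨x, hx, rfl⟩ := Finset.mem_image.1 hZ
  have h1 : (U.filter fun y => U.filter (r y) = U.filter (r x)) = U.filter (r x) := by
    refine Finset.filter_congr fun y hy => ⟨fun h => ?_, fun h => ?_⟩
    · have : y ∈ U.filter (r y) := Finset.mem_filter.2 ⟨hy, hr.refl y⟩
      rw [h] at this
      exact (Finset.mem_filter.1 this).2
    · exact Finset.filter_congr fun z _ =>
        ⟨fun h' => hr.trans h h', fun h' => hr.trans (hr.symm h) h'⟩
  rw [h1, Finset.sum_congr rfl (g := fun y => f y * h x) fun y hy => by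
    rw [hh x hx y (Finset.mem_filter.1 hy).1 (Finset.mem_filter.1 hy).2], ← Finset.sum_mul, hf x hx,
    zero_mul]

open Classical in
/-- If the sum of `f` over every interval saturated for a non-crossing equivalence relation
vanishes, then so does its sum over every class. -/
theorem sum_class_eq_zero {r : Fin M → Fin M → Prop} (hr : Equivalence r)
    (hcr : ∀ a b c d, a < b → b < c → c < d → r a c → r b d → r a b) (T : Finset (Fin M))
    (f : Fin M → ℤ) (hf : ∀ a b, (∀ i ∈ T, ∀ j ∈ T, r i j → a ≤ i ∧ i ≤ b → a ≤ j ∧ j ≤ b) →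
      ∑ i ∈ T with a ≤ i ∧ i ≤ b, f i = 0) (x : Fin M) (hx : x ∈ T) :
    ∑ y ∈ T with r x y, f y = 0 := by
  -- Induction on the length of the hull [e₁, e₂] of the class of x. The hull is saturated because a
  -- class leaving it would cross the class of x.
  have key : ∀ (n : ℕ) (x e₁ e₂ : Fin M), x ∈ T → e₁ ∈ T → e₂ ∈ T → r x e₁ → r x e₂ →
      (∀ y ∈ T, r x y → e₁ ≤ y ∧ y ≤ e₂) → (e₂ : ℕ) - e₁ < n → ∑ y ∈ T with r x y, f y = 0 := by
    intro n
    induction n with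
    | zero => intros; omega
    | succ n ih =>
      intro x e₁ e₂ hx he₁ he₂ hr₁ hr₂ hE hn
      have hsat : ∀ i ∈ T, ∀ j ∈ T, r i j → e₁ ≤ i ∧ i ≤ e₂ → e₁ ≤ j ∧ j ≤ e₂ := by
        intro i hi j hj hij hie
        by_cases hxi : r x i
        · exact hE j hj (hr.trans hxi hij)
        have hi₁ : e₁ < i := hie.1.lt_of_ne fun h => hxi (h ▸ hr₁)
        have hi₂ : i < e₂ := hie.2.lt_of_ne fun h => hxi (h ▸ hr₂)
        have h12 : r e₁ e₂ := hr.trans (hr.symm hr₁) hr₂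
        constructor
        · by_contra hlt
          have := hcr j e₁ i e₂ (not_le.1 hlt) hi₁ hi₂ (hr.symm hij) h12
          exact hxi (hr.trans hr₁ (hr.trans (hr.symm this) (hr.symm hij)))
        · by_contra hlt
          have := hcr e₁ i e₂ j hi₁ hi₂ (not_le.1 hlt) h12 hij
          exact hxi (hr.trans hr₁ this)
      have h1 := hf e₁ e₂ hsat
      set H := T.filter fun i => e₁ ≤ i ∧ i ≤ e₂ with hH
      -- The other classes meeting the hull lie inside it and miss e₁, so their hulls are shorter
      -- and their sums vanish by induction.
      have h2 : ∑ y ∈ H with ¬ r x y, f y = 0 := by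
        have := sum_mul_eq_zero_of_classes hr (H.filter fun y => ¬ r x y) f (fun _ => 1) ?_
          (fun _ _ _ _ _ => rfl)
        · simpa using this
        intro z hz
        simp only [hH, Finset.mem_filter] at hz
        have e : ((H.filter fun y => ¬ r x y).filter fun y => r z y) = T.filter fun y => r z y := by
          ext y
          simp only [hH, Finset.mem_filter]
          constructor
          · exact fun h => ⟨h.1.1.1, h.2⟩
          · exact fun h => ⟨⟨⟨h.1, hsat z hz.1.1 y h.1 h.2 hz.1.2⟩,
              fun h' => hz.2 (hr.trans h' (hr.symm h.2))⟩, h.2⟩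
        rw [e]
        have hne : (T.filter fun y => r z y).Nonempty :=
          ⟨z, Finset.mem_filter.2 ⟨hz.1.1, hr.refl z⟩⟩
        obtain ⟨m₁, hm₁, hmin⟩ := Finset.exists_min_image _ id hne
        obtain ⟨m₂, hm₂, hmax⟩ := Finset.exists_max_image _ id hne
        simp only [Finset.mem_filter, id_eq] at hm₁ hm₂ hmin hmax
        refine ih z m₁ m₂ hz.1.1 hm₁.1 hm₂.1 hm₁.2 hm₂.2
          (fun y hy hzy => ⟨hmin y ⟨hy, hzy⟩, hmax y ⟨hy, hzy⟩⟩) ?_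
        have b1 := hsat z hz.1.1 m₁ hm₁.1 hm₁.2 hz.1.2
        have b2 := hsat z hz.1.1 m₂ hm₂.1 hm₂.2 hz.1.2
        have b3 : e₁ ≠ m₁ := fun h => hz.2 (hr.trans (h ▸ hr₁) (hr.symm hm₁.2))
        have b4 := hmin m₂ hm₂
        have b5 : e₁ < m₁ := lt_of_le_of_ne b1.1 b3
        rw [Fin.lt_def] at b5
        have b6 := b2.2
        rw [Fin.le_def] at b6 b4
        omega
      have h3 := Finset.sum_filter_add_sum_filter_not H (fun y => r x y) f
      rw [h1, h2, add_zero] at h3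
      rw [← h3]
      refine Finset.sum_congr ?_ fun _ _ => rfl
      ext y
      simp only [hH, Finset.mem_filter]
      exact ⟨fun h => ⟨⟨h.1, hE y h.1 h.2⟩, h.2⟩, fun h => ⟨h.1.1, h.2⟩⟩
  have hne : (T.filter fun y => r x y).Nonempty := ⟨x, Finset.mem_filter.2 ⟨hx, hr.refl x⟩⟩
  obtain ⟨m₁, hm₁, hmin⟩ := Finset.exists_min_image _ id hne
  obtain ⟨m₂, hm₂, hmax⟩ := Finset.exists_max_image _ id hne
  simp only [Finset.mem_filter, id_eq] at hm₁ hm₂ hmin hmax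
  exact key _ x m₁ m₂ hx hm₁.1 hm₂.1 hm₁.2 hm₂.2
    (fun y hy hxy => ⟨hmin y ⟨hy, hxy⟩, hmax y ⟨hy, hxy⟩⟩) (Nat.lt_succ_self _)

/-- For non-crossing permutations `σ`, `ρ` of disjoint sets `S`, `T` and a function `f` whose sums
over the invariant intervals of `S` and of `T` vanish, the `f`-weighted number of inversions between
`S` and `T` is zero. -/
theorem sum_inversions_eq_zero {σ ρ : Equiv.Perm (Fin M)} (h : NonCrossing σ ρ)
    {S T : Finset (Fin M)} (hST : Disjoint S T) (hS : ∀ i ∉ S, σ i = i) (hT : ∀ i ∉ T, ρ i = i)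
    (f : Fin M → ℤ)
    (hfS : ∀ a b, (∀ i, a ≤ i ∧ i ≤ b ↔ a ≤ σ i ∧ σ i ≤ b) →
      ∑ i ∈ S with a ≤ i ∧ i ≤ b, f i = 0)
    (hfT : ∀ a b, (∀ i, a ≤ i ∧ i ≤ b ↔ a ≤ ρ i ∧ ρ i ≤ b) →
      ∑ i ∈ T with a ≤ i ∧ i ≤ b, f i = 0) :
    ∑ b ∈ T, f b * ∑ a ∈ S with b < a, f a = 0 := by
  classical
  have hd : σ.Disjoint ρ := fun x => by
    by_cases hx : x ∈ S
    · exact Or.inr (hT x (Finset.disjoint_left.1 hST hx))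
    · exact Or.inl (hS x hx)
  refine sum_mul_eq_zero_of_classes (gapEquiv_equivalence σ) T f (fun b => ∑ a ∈ S with b < a, f a)
    (sum_class_eq_zero (gapEquiv_equivalence σ)
      (fun a b c d hab hbc hcd hac hbd => GapEquiv.of_crossing hab hbc hcd hac hbd) T f ?_) ?_
  -- Each i is gap equivalent to ρ i, so a saturated interval is ρ-invariant.
  · intro a b hsat
    refine hfT a b fun i => ?_
    by_cases hi : i ∈ T
    · have hi' : ρ i ∈ T := by
        by_contra h'
        have := ρ.injective (hT _ h')
        exact h' (this.symm ▸ hi)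
      have hg := h.gapEquiv hd i
      exact ⟨hsat i hi _ hi' hg, hsat _ hi' i hi ((gapEquiv_equivalence σ).symm hg)⟩
    · rw [hT i hi]
  · have key : ∀ x ∈ T, ∀ y ∈ T, x ≤ y → GapEquiv σ x y →
        ∑ a ∈ S with x < a, f a = ∑ a ∈ S with y < a, f a := by
      intro x hx y hy hxy hg
      have hyS : y ∉ S := Finset.disjoint_right.1 hST hy
      -- Gap equivalence concerns [x, y), while the hypothesis on f concerns [x, y]; the end y makes
      -- no difference, being fixed by σ.
      have h0 := hfS x y fun i => by
        have h1 := hg i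
        have h2 : σ i = y → i = y := fun h' => σ.injective (h'.trans (hS y hyS).symm)
        have h3 := hS y hyS
        grind
      rw [← Finset.sum_filter_add_sum_filter_not (S.filter fun a => x < a) (fun a => y < a),
        Finset.filter_filter, Finset.filter_filter]
      have e1 : (S.filter fun a => x < a ∧ y < a) = S.filter fun a => y < a := by
        refine Finset.filter_congr fun a _ => ?_
        grind
      have e2 : (S.filter fun a => x < a ∧ ¬ y < a) = S.filter fun a => x ≤ a ∧ a ≤ y := by
        refine Finset.filter_congr fun a ha => ?_
        have : a ≠ x := fun h' => Finset.disjoint_left.1 hST ha (h' ▸ hx)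
        grind
      rw [e1, e2, h0, add_zero]
    intro x hx y hy hxy
    rcases le_total x y with hle | hle
    · exact key x hx y hy hle hxy
    · exact (key y hy x hx hle ((gapEquiv_equivalence σ).symm hxy)).symm

end NonCrossing

/-! ### The permutation of a matrix -/

section PermSpec

variable {n m : ℕ}

/-- Going cyclically backwards from `j`, the column `x` comes strictly before the column `i`. -/
def CloserBack (x i j : Fin m) : Prop :=
  (i < x ∧ x < j) ∨ (x < j ∧ j ≤ i) ∨ (j ≤ i ∧ i < x)

/-- The number in `[1, m]` of backward steps from `j` to `x`. -/
def backSteps (x j : Fin m) : ℕ := if x < j then j - x else j + m - x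

theorem closerBack_iff (x i j : Fin m) : CloserBack x i j ↔ backSteps x j < backSteps i j := by
  unfold CloserBack backSteps
  simp only [Fin.lt_def, Fin.le_def]
  have := x.2; have := i.2; have := j.2
  split_ifs <;> omega

theorem val_cyc_modEq (z : ℤ) (j : Fin m) : ((cyc z j : Fin m) : ℤ) ≡ j + z [ZMOD m] := by
  have hrot : ∀ i : Fin m, ((finRotate m i : Fin m) : ℤ) ≡ i + 1 [ZMOD m] := by
    intro i
    rcases m with _ | m
    · exact i.elim0
    · rw [finRotate_apply, Fin.val_add, Int.ModEq]
      push_cast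
      rcases m with _ | m
      · simp
      · simp
  have hstep : ∀ z : ℤ, ((cyc (z + 1) j : Fin m) : ℤ) ≡ cyc z j + 1 [ZMOD m] := by
    intro z
    have : cyc (z + 1) j = finRotate m (cyc z j) := by
      rw [add_comm, ← cyc_cyc]
      simp [cyc]
    rw [this]
    exact hrot _
  induction z using Int.induction_on with
  | zero => simp [cyc]
  | succ k ih =>
    refine (hstep _).trans ?_
    rw [← add_assoc]
    exact ih.add_right 1
  | pred k ih =>
    have h := hstep (-(k : ℤ) - 1)
    rw [sub_add_cancel] at h
    have h2 := (h.symm.trans ih).sub_right 1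
    rw [add_sub_cancel_right] at h2
    rwa [← add_sub_assoc]

theorem cyc_neg_eq_iff {e : ℕ} (he : 1 ≤ e) (hem : e ≤ m) (j x : Fin m) :
    cyc (-(e : ℤ)) j = x ↔ backSteps x j = e := by
  have h := val_cyc_modEq (-(e : ℤ)) j
  have h0 : (0 : ℤ) < m := by omega
  have key : ∀ y : Fin m, (y : ℤ) ≡ j + -(e : ℤ) [ZMOD m] → backSteps y j = e := by
    intro y hy
    obtain ⟨k, hk⟩ := hy.dvd
    unfold backSteps
    simp only [Fin.lt_def]
    have h1 := y.2; have h2 := j.2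
    have hk1 : k < 1 := by
      by_contra hk1
      have : (m : ℤ) * 1 ≤ m * k := mul_le_mul_of_nonneg_left (by omega) h0.le
      omega
    have hk2 : -2 < k := by
      by_contra hk2
      have : (m : ℤ) * k ≤ m * (-2) := mul_le_mul_of_nonneg_left (by omega) h0.le
      omega
    obtain rfl | rfl : k = 0 ∨ k = -1 := by omega
    · rw [if_pos (by omega)]
      omega
    · rw [if_neg (by omega)]
      omega
  constructor
  · rintro rfl
    exact key _ h
  · intro hx
    have h1 := key _ h
    generalize cyc (-(e : ℤ)) j = y at h1
    unfold backSteps at h1 hx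
    have := x.2; have := j.2; have := y.2
    simp only [Fin.lt_def] at h1 hx
    ext
    split_ifs at h1 hx <;> omega

theorem backSteps_mem (x j : Fin m) : 1 ≤ backSteps x j ∧ backSteps x j ≤ m := by
  unfold backSteps
  simp only [Fin.lt_def]
  have := x.2; have := j.2
  split_ifs <;> omega

/-- The characterization of `i = π(A)(j)`. -/
def PermSpec (A : Matrix (Fin n) (Fin m) ℝ) (j i : Fin m) : Prop :=
  (A.col j = 0 ∧ i = j) ∨
    (A.col j ∈ Submodule.span ℝ (A.col '' {x | CloserBack x i j ∨ x = i}) ∧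
      A.col j ∉ Submodule.span ℝ (A.col '' {x | CloserBack x i j}))

/-- Replaces step counts of the rotation by order relations between columns, which monotone
embeddings of the blocks preserve. A column outside the span of the others has distance m, hence i =
j with all other columns closer. -/
theorem permSpec_perm (A : Matrix (Fin n) (Fin m) ℝ) (j : Fin m) : PermSpec A j (perm A j) := by
  have hmem : A.col j ∈ Submodule.span ℝ
      ((fun e : ℕ => A.col (cyc (-(e : ℤ)) j)) '' Set.Icc 1 (backDist A j)) := backDist_mem A j
  have hle : backDist A j ≤ m := by
    apply Nat.sInf_le
    refine Submodule.subset_span ⟨m, ⟨Nat.one_le_iff_ne_zero.2 ?_, le_rfl⟩, ?_⟩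
    · rintro rfl
      exact j.elim0
    · simp [cyc, finRotate_pow_self]
  have hnot : ∀ d < backDist A j, A.col j ∉ Submodule.span ℝ
      ((fun e : ℕ => A.col (cyc (-(e : ℤ)) j)) '' Set.Icc 1 d) := fun d hd =>
    Nat.notMem_of_lt_sInf hd
  change PermSpec A j (cyc (-(backDist A j : ℤ)) j)
  generalize backDist A j = d at hmem hnot hle
  rcases d with _ | d
  · left
    exact ⟨by simpa using hmem, by simp [cyc]⟩
  · right
    have hi : backSteps (cyc (-((d + 1 : ℕ) : ℤ)) j) j = d + 1 :=
      (cyc_neg_eq_iff (by omega) hle j _).1 rfl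
    generalize cyc (-((d + 1 : ℕ) : ℤ)) j = i at hi
    have hset : ∀ d' ≤ m, (fun e : ℕ => A.col (cyc (-(e : ℤ)) j)) '' Set.Icc 1 d' =
        A.col '' {x | backSteps x j ≤ d'} := by
      intro d' hd'
      ext v
      constructor
      · rintro ⟨e, ⟨h1, h2⟩, rfl⟩
        refine ⟨_, ?_, rfl⟩
        have := (cyc_neg_eq_iff h1 (h2.trans hd') j _).1 rfl
        simp [this, h2]
      · rintro ⟨x, hx, rfl⟩
        refine ⟨backSteps x j, ⟨(backSteps_mem x j).1, hx⟩, ?_⟩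
        have := (cyc_neg_eq_iff (backSteps_mem x j).1 (backSteps_mem x j).2 j x).2 rfl
        simp [this]
    have hinj : ∀ x, backSteps x j = backSteps i j → x = i := by
      intro x hx
      have h1 := (cyc_neg_eq_iff (backSteps_mem x j).1 (backSteps_mem x j).2 j x).2 rfl
      have h2 := (cyc_neg_eq_iff (backSteps_mem i j).1 (backSteps_mem i j).2 j i).2 rfl
      rw [← h1, ← h2, hx]
    constructor
    · rw [hset _ hle] at hmem
      convert hmem using 3
      ext x
      simp only [Set.mem_ofPred_eq, closerBack_iff]
      constructor
      · rintro (h | rfl) <;> omega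
      · intro h
        by_cases hx : backSteps x j = backSteps i j
        · exact Or.inr (hinj x hx)
        · left
          omega
    · have := hnot d (Nat.lt_succ_self d)
      rw [hset _ (by omega)] at this
      convert this using 4
      ext x
      simp only [Set.mem_ofPred_eq, closerBack_iff]
      omega

/-- The sets of closer columns form a chain, so there is only one place where column j enters the
span. -/
theorem PermSpec.unique {A : Matrix (Fin n) (Fin m) ℝ} {j i i' : Fin m} (h : PermSpec A j i)
    (h' : PermSpec A j i') : i = i' := by
  rcases h with ⟨h0, rfl⟩ | ⟨h1, h2⟩
  · rcases h' with ⟨_, rfl⟩ | ⟨_, h2⟩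
    · rfl
    · exact absurd (h0 ▸ Submodule.zero_mem _) h2
  · rcases h' with ⟨h0, rfl⟩ | ⟨h1', h2'⟩
    · exact absurd (h0 ▸ Submodule.zero_mem _) h2
    · by_contra hne
      have hcases : CloserBack i i' j ∨ CloserBack i' i j := by
        unfold CloserBack
        grind
      rcases hcases with hc | hc
      · refine h2' (Submodule.span_mono (Set.image_mono ?_) h1)
        rintro x (hx | rfl)
        · simp only [Set.mem_ofPred_eq, closerBack_iff] at hx hc ⊢
          omega
        · exact hc
      · refine h2 (Submodule.span_mono (Set.image_mono ?_) h1')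
        rintro x (hx | rfl)
        · simp only [Set.mem_ofPred_eq, closerBack_iff] at hx hc ⊢
          omega
        · exact hc

/-! ### Ranks of invariant intervals -/

/-- The span of the columns in an interval that is invariant under `π(A)` is independent from the
span of the other columns. -/
theorem disjoint_span_of_invariant (A : Matrix (Fin n) (Fin m) ℝ) {p : Fin m → Prop}
    (hp : ∀ x y z, x ≤ y → y ≤ z → p x → p z → p y) (hinv : ∀ j, p j ↔ p (perm A j)) :
    Disjoint (Submodule.span ℝ (A.col '' {j | ¬ p j}))
      (Submodule.span ℝ (A.col '' {j | p j})) := by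
  -- The columns of the interval are adjoined from left to right. A column outside the span of its
  -- predecessors in the interval must also avoid that span enlarged by all exterior columns.
  have key : ∀ k : ℕ, Disjoint (Submodule.span ℝ (A.col '' {j | ¬ p j}))
      (Submodule.span ℝ (A.col '' {j | p j ∧ (j : ℕ) < k})) := by
    intro k
    induction k with
    | zero => simp [Set.image_empty]
    | succ k ih =>
      by_cases hk : ∃ j : Fin m, (j : ℕ) = k ∧ p j
      · obtain ⟨j, rfl, hj⟩ := hk
        have hset : {i : Fin m | p i ∧ (i : ℕ) < j + 1} =
            insert j {i : Fin m | p i ∧ (i : ℕ) < j} := by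
          ext i
          simp only [Set.mem_ofPred_eq, Set.mem_insert_iff, Fin.ext_iff]
          constructor
          · intro h
            by_cases h' : (i : ℕ) = j
            · exact Or.inl h'
            · exact Or.inr ⟨h.1, by omega⟩
          · rintro (h | h)
            · rw [Fin.ext h]
              exact ⟨hj, by omega⟩
            · exact ⟨h.1, by omega⟩
        rw [hset, Set.image_insert_eq]
        by_cases hmem : A.col j ∈
            Submodule.span ℝ (A.col '' {i : Fin m | p i ∧ (i : ℕ) < j})
        · rwa [Submodule.span_insert_eq_span hmem]
        · rw [Submodule.span_insert, sup_comm]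
          refine Disjoint.disjoint_sup_right_of_disjoint_sup_left ih ?_
          rw [← Submodule.span_union, ← Set.image_union]
          refine Submodule.disjoint_span_singleton_of_notMem ?_
          have hi := (hinv j).1 hj
          rcases permSpec_perm A j with ⟨h0, _⟩ | ⟨h1, h2⟩
          · exact absurd (h0 ▸ Submodule.zero_mem _) hmem
          · generalize perm A j = i at hi h1 h2
            -- If i = π(j) < j, the columns from i to j - 1 lie in the interval and already span
            -- column j. If j ≤ i, the columns closer than i include the whole exterior and all
            -- predecessors in the interval, and they do not span column j.
            rcases lt_or_ge i j with hij | hij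
            · refine absurd (Submodule.span_mono (Set.image_mono ?_) h1) hmem
              rintro x (hx | rfl)
              · have h3 := hp i x j
                unfold CloserBack at hx
                simp only [Set.mem_ofPred_eq]
                rw [← Fin.lt_def]
                grind
              · exact ⟨hi, hij⟩
            · refine fun h3 => h2 (Submodule.span_mono (Set.image_mono ?_) h3)
              rintro x (hx | hx)
              · have h4 := hp j x i
                simp only [Set.mem_ofPred_eq, CloserBack] at hx ⊢
                grind
              · simp only [Set.mem_ofPred_eq, CloserBack] at hx ⊢
                rw [← Fin.lt_def] at hx
                grind
      · have hset : {i : Fin m | p i ∧ (i : ℕ) < k + 1} =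
            {i : Fin m | p i ∧ (i : ℕ) < k} := by
          ext i
          have : (i : ℕ) = k → ¬ p i := fun h h' => hk ⟨i, h, h'⟩
          simp only [Set.mem_ofPred_eq]
          constructor
          · intro h
            refine ⟨h.1, ?_⟩
            by_contra h'
            exact this (by omega) h.1
          · exact fun h => ⟨h.1, by omega⟩
        rwa [hset]
  have := key m
  simpa using this

/-- The number of elements of a basis in an invariant interval is the rank of the interval. -/
theorem card_filter_eq_finrank (A : Matrix (Fin n) (Fin m) ℝ) {p : Fin m → Prop} [DecidablePred p]
    (hp : ∀ x y z, x ≤ y → y ≤ z → p x → p z → p y)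
    (hinv : ∀ j, p j ↔ p (perm A j)) {I : Fin n ↪o Fin m}
    (hI : maxMinor A I ≠ 0) :
    (Finset.univ.filter fun i => p (I i)).card =
      Module.finrank ℝ (Submodule.span ℝ (A.col '' {j | p j})) := by
  have hli : LinearIndependent ℝ fun i => A.col (I i) :=
    Matrix.linearIndependent_cols_of_det_ne_zero hI
  have hle : ∀ (p : Fin m → Prop) [DecidablePred p], (Finset.univ.filter fun i => p (I i)).card ≤
      Module.finrank ℝ (Submodule.span ℝ (A.col '' {j | p j})) := by
    intro p _
    have h1 : LinearIndependent ℝ fun i : {i // p (I i)} => A.col (I i) :=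
      hli.comp _ Subtype.val_injective
    have h2 := finrank_span_eq_card h1
    rw [Fintype.card_subtype] at h2
    rw [← h2]
    refine Submodule.finrank_mono (Submodule.span_mono ?_)
    rintro _ ⟨i, rfl⟩
    exact ⟨I i, i.2, rfl⟩
  -- Independence bounds the basis elements inside and outside by the two ranks. These ranks add up
  -- to at most n, the size of the basis, so both bounds are equalities.
  have h1 := hle fun j => p j
  have h2 := hle fun j => ¬ p j
  have h3 := Submodule.finrank_add_finrank_le_of_disjoint (disjoint_span_of_invariant A hp hinv)
  have h4 := Finset.card_filter_add_card_filter_not (s := (Finset.univ : Finset (Fin n)))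
    (fun i => p (I i))
  simp only [Finset.card_univ, Fintype.card_fin, Module.finrank_fin_fun] at h3 h4
  omega

/-- Two bases have equally many elements in an invariant interval. -/
theorem card_filter_eq_card_filter (A : Matrix (Fin n) (Fin m) ℝ)
    {p : Fin m → Prop} [DecidablePred p]
    (hp : ∀ x y z, x ≤ y → y ≤ z → p x → p z → p y)
    (hinv : ∀ j, p j ↔ p (perm A j)) {I J : Fin n ↪o Fin m}
    (hI : maxMinor A I ≠ 0) (hJ : maxMinor A J ≠ 0) :
    (Finset.univ.filter fun i => p (I i)).card =
      (Finset.univ.filter fun i => p (J i)).card := by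
  rw [card_filter_eq_finrank A hp hinv hI, card_filter_eq_finrank A hp hinv hJ]

/-- The permutation of an irreducible matrix in reduced row echelon form is a derangement. -/
theorem perm_apply_ne {A : Matrix (Fin n) (Fin m) ℝ} (hA : IsRREF A) (hirr : IsIrreducible A)
    (j : Fin m) : perm A j ≠ j := by
  intro hj
  have hspec := permSpec_perm A j
  rw [hj] at hspec
  rcases hspec with ⟨h0, -⟩ | ⟨-, h⟩
  · obtain ⟨i, hi⟩ := hirr.1 j
    exact hi (congrFun h0 i)
  have hset : {x : Fin m | CloserBack x j j} = {x | x ≠ j} := by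
    ext x
    simp only [CloserBack, Set.mem_ofPred_eq]
    grind
  rw [hset] at h
  set p := pivotEmb hA
  have hexp : ∀ x, A.col x = ∑ i, A i x • A.col (p i) := by
    intro x
    ext i'
    simp [p, apply_pivotEmb, Finset.sum_apply]
  by_cases hp : ∃ i, p i = j
  · obtain ⟨i, rfl⟩ := hp
    -- A second nonzero entry in the pivot row allows the expansion of column x in the pivot columns
    -- to be solved for the pivot column itself.
    obtain ⟨x, hx, hAx⟩ : ∃ x, x ≠ p i ∧ A i x ≠ 0 := by
      obtain ⟨x, y, hxy, h1, h2⟩ := hirr.2 i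
      by_cases hxi : x = p i
      · exact ⟨y, fun h' => hxy (hxi.trans h'.symm), h2⟩
      · exact ⟨x, hxi, h1⟩
    have h1 := hexp x
    rw [← Finset.add_sum_erase _ _ (Finset.mem_univ i)] at h1
    refine h ?_
    have h2 : A.col (p i) =
        (A i x)⁻¹ • (A.col x - ∑ k ∈ Finset.univ.erase i, A k x • A.col (p k)) := by
      rw [h1, add_sub_cancel_right, smul_smul, inv_mul_cancel₀ hAx, one_smul]
    rw [h2]
    refine Submodule.smul_mem _ _ (Submodule.sub_mem _ (Submodule.subset_span ⟨x, hx, rfl⟩)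
      (Submodule.sum_mem _ fun k hk => Submodule.smul_mem _ _
        (Submodule.subset_span ⟨p k, ?_, rfl⟩)))
    exact fun h' => (Finset.ne_of_mem_erase hk) (p.injective h')
  · refine h ?_
    rw [hexp j]
    exact Submodule.sum_mem _ fun k _ => Submodule.smul_mem _ _
      (Submodule.subset_span ⟨p k, fun h' => hp ⟨k, h'⟩, rfl⟩)

end PermSpec

/-! ### Signs of permutations and reduced row echelon forms -/

section Sign

theorem sign_eq_signAux {n : ℕ} (σ : Equiv.Perm (Fin n)) :
    Equiv.Perm.sign σ = Equiv.Perm.signAux σ := by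
  induction σ using Equiv.Perm.swap_induction_on with
  | one => rw [map_one, Equiv.Perm.signAux_one]
  | swap_mul f x y hxy ih =>
    rw [map_mul, Equiv.Perm.signAux_mul, Equiv.Perm.sign_swap hxy, Equiv.Perm.signAux_swap hxy, ih]

theorem sign_eq_neg_one_pow_inversions {n : ℕ} (σ : Equiv.Perm (Fin n)) :
    Equiv.Perm.sign σ = (-1) ^ ∑ a, ∑ b, if b < a ∧ σ a < σ b then 1 else 0 := by
  rw [sign_eq_signAux, Equiv.Perm.signAux, ← Finset.sum_product', ← Finset.prod_pow_eq_pow_sum]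
  refine Eq.trans ?_ (Finset.prod_subset_one_on_sdiff (s₁ := (Equiv.Perm.finPairsLT n).map
    (Equiv.sigmaEquivProd (Fin n) (Fin n)).toEmbedding) (Finset.subset_univ _) ?_
    (fun _ _ => rfl))
  · rw [Finset.prod_map]
    refine Finset.prod_congr rfl fun x hx => ?_
    have hx' := Equiv.Perm.mem_finPairsLT.1 hx
    have hne : σ x.1 ≠ σ x.2 := fun h => hx'.ne (σ.injective h).symm
    simp only [Equiv.coe_toEmbedding, Equiv.sigmaEquivProd_apply, hx', true_and]
    by_cases h : σ x.1 < σ x.2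
    · simp [h, h.le]
    · simp [h, (not_lt.1 h).lt_of_ne hne.symm]
  · rintro ⟨a, b⟩ hab
    have : ¬ b < a := by
      intro h
      refine (Finset.mem_sdiff.1 hab).2 (Finset.mem_map.2 ⟨⟨a, b⟩, ?_, rfl⟩)
      exact Equiv.Perm.mem_finPairsLT.2 h
    simp [this]

variable {N M : ℕ}

theorem pivotEmb_eq_of_abs_eq {A B : Matrix (Fin N) (Fin M) ℝ} (hA : IsRREF A) (hB : IsRREF B)
    (h : ∀ i j, A i j = 0 ↔ B i j = 0) (i : Fin N) : pivotEmb hA i = pivotEmb hB i := by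
  apply le_antisymm
  · by_contra hlt
    have h1 := (h i _).1 (apply_eq_zero_of_lt_pivotEmb hA (not_le.1 hlt))
    simp [apply_pivotEmb] at h1
  · by_contra hlt
    have h1 := (h i _).2 (apply_eq_zero_of_lt_pivotEmb hB (not_le.1 hlt))
    simp [apply_pivotEmb] at h1

/-- An entry of a matrix in reduced row echelon form outside the pivot columns is, up to a sign
that depends only on the position and the pivots, a maximal minor. -/
theorem exists_maxMinor_eq {P : Fin N ↪o Fin M} (i : Fin N) {j : Fin M} (hj : ∀ i, P i ≠ j) :
    ∃ (I : Fin N ↪o Fin M) (ε : ℤˣ), ∀ A : Matrix (Fin N) (Fin M) ℝ, A.submatrix id P = 1 →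
      maxMinor A I = ((ε : ℤ) : ℝ) * A i j := by
  -- Exchanging the i-th pivot column for j in the identity matrix leaves the determinant A i j; the
  -- sign ε comes from sorting the columns.
  set f : Fin N → Fin M := Function.update P i j with hf
  have hinj : Function.Injective f := by
    intro a b hab
    by_cases ha : a = i <;> by_cases hb : b = i
    · rw [ha, hb]
    · subst ha
      simp only [hf, Function.update_self, Function.update_of_ne hb] at hab
      exact absurd hab.symm (hj b)
    · subst hb
      simp only [hf, Function.update_self, Function.update_of_ne ha] at hab
      exact absurd hab (hj a)
    · simp only [hf, Function.update_of_ne ha, Function.update_of_ne hb] at hab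
      exact P.injective hab
  set σ := Tuple.sort f
  refine ⟨OrderEmbedding.ofStrictMono (f ∘ σ) ((Tuple.monotone_sort f).strictMono_of_injective
    (hinj.comp σ.injective)), Equiv.Perm.sign σ, fun A hA => ?_⟩
  have h1 := Matrix.det_permute' σ (A.submatrix id f)
  have h2 : A.submatrix id f = (1 : Matrix (Fin N) (Fin N) ℝ).updateCol i (fun k => A k j) := by
    ext a b
    by_cases hb : b = i
    · subst hb
      simp [hf]
    · rw [Matrix.updateCol_ne hb, ← hA]
      simp [hf, Function.update_of_ne hb]
  have h3 : (A.submatrix id f).det = A i j := by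
    rw [h2, ← Matrix.cramer_apply, Matrix.cramer_one]
    rfl
  rw [h3] at h1
  exact h1

/-- A totally nonnegative matrix is determined by the absolute values of its entries. -/
theorem IsTNN.eq_of_abs_eq {A B : Matrix (Fin N) (Fin M) ℝ} (hA : IsTNN A) (hB : IsTNN B)
    (h : ∀ i j, A i j = B i j ∨ A i j = -B i j) : A = B := by
  have hz : ∀ i j, A i j = 0 ↔ B i j = 0 := by
    intro i j
    rcases h i j with h | h <;> simp [h]
  have hP := pivotEmb_eq_of_abs_eq hA.1 hB.1 hz
  ext i j
  by_cases hj : ∃ i', pivotEmb hA.1 i' = j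
  · obtain ⟨i', rfl⟩ := hj
    have h1 := apply_pivotEmb hA.1 i' i
    have h2 := apply_pivotEmb hB.1 i' i
    rw [← hP] at h2
    exact h1.trans h2.symm
  · push Not at hj
    obtain ⟨I, ε, hI⟩ := exists_maxMinor_eq i hj
    have hIA := hI A (submatrix_pivotEmb hA.1)
    have hIB := hI B (by
      rw [← submatrix_pivotEmb hB.1]
      congr 1
      exact funext hP)
    by_cases h0 : B i j = 0
    · rw [h0, (hz i j).2 h0]
    have h0' : A i j ≠ 0 := fun h' => h0 ((hz i j).1 h')
    have hε : ((ε : ℤ) : ℝ) ≠ 0 := by exact_mod_cast ε.ne_zero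
    have h1 := hA.2 I (show maxMinor A I ≠ 0 by rw [hIA]; exact mul_ne_zero hε h0')
    have h2 := hB.2 I (show maxMinor B I ≠ 0 by rw [hIB]; exact mul_ne_zero hε h0)
    rw [hIA] at h1
    rw [hIB] at h2
    rcases h i j with h | h
    · exact h
    · rw [h] at h1
      linarith

end Sign

/-! ### The `κ`-direct sum -/

section SortedPairs

variable {K : ℕ}

theorem strictMono_sortedPairs (s : Fin K → ℕ) {key : (Σ k, Fin (s k)) → ℝ}
    (hkey : Function.Injective key) : StrictMono fun i => key (sortedPairs s key i) :=
  (Tuple.monotone_sort (key ∘ finSigmaFinEquiv.symm)).strictMono_of_injective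
    (hkey.comp (sortedPairs s key).injective)

/-- The index of a pair is the total size of the earlier blocks plus its index within its block. The
lexicographic order is needed to read shuffle signs as inversion counts. -/
theorem finSigmaFinEquiv_lt_iff {s : Fin K → ℕ} (q q' : Σ k, Fin (s k)) :
    finSigmaFinEquiv q < finSigmaFinEquiv q' ↔
      q.1 < q'.1 ∨ (q.1 = q'.1 ∧ (q.2 : ℕ) < q'.2) := by
  set F : ℕ → ℕ := fun k => ∑ i ∈ Finset.range k, if h : i < K then s ⟨i, h⟩ else 0 with hF
  have hval : ∀ q : Σ k, Fin (s k), (finSigmaFinEquiv q : ℕ) = F q.1 + q.2 := by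
    intro q
    rw [finSigmaFinEquiv_apply]
    simp only [hF]
    rw [Finset.sum_range]
    congr 1
    refine Finset.sum_congr rfl fun i _ => ?_
    rw [dif_pos (i.2.trans q.1.2)]
    rfl
  have hmono : Monotone F := fun a b hab =>
    Finset.sum_le_sum_of_subset (Finset.range_mono hab)
  have hstep : ∀ q q' : Σ k, Fin (s k), q.1 < q'.1 → F q.1 + q.2 < F q'.1 + q'.2 := by
    intro q q' h
    have h1 : F q.1 + s q.1 ≤ F q'.1 := by
      refine le_trans (le_of_eq ?_) (hmono (Nat.succ_le_of_lt h))
      simp [hF, Finset.sum_range_succ]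
    have := q.2.2
    omega
  rw [Fin.lt_def, hval, hval]
  rcases lt_trichotomy q.1 q'.1 with h | h | h
  · simp [h, hstep _ _ h]
  · obtain ⟨k, x⟩ := q
    obtain ⟨k', y⟩ := q'
    obtain rfl : k = k' := h
    simp
  · have h1 := hstep _ _ h
    constructor
    · intro h2
      omega
    · rintro (h2 | h2)
      · exact absurd h2 h.not_gt
      · exact absurd h2.1 h.ne'

variable (n m : Fin K → ℕ) (κ : ∀ k, Fin (m k) → ℝ)

theorem colOrder_position (k : Fin K) (x : Fin (m k)) :
    colOrder m κ (position m κ k x) = ⟨k, x⟩ := by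
  simp [position]

theorem position_colOrder (j : Fin (∑ k, m k)) :
    position m κ (colOrder m κ j).1 (colOrder m κ j).2 = j := by
  simp [position]

theorem exists_eq_position (j : Fin (∑ k, m k)) : ∃ k x, j = position m κ k x :=
  ⟨_, _, (position_colOrder m κ j).symm⟩

theorem sortedKappa_position (k : Fin K) (x : Fin (m k)) :
    sortedKappa m κ (position m κ k x) = κ k x := by
  rw [sortedKappa, colOrder_position]

variable {m κ} (hκ : Function.Injective fun q : Σ k, Fin (m k) => κ q.1 q.2)
include hκ

theorem strictMono_sortedKappa : StrictMono (sortedKappa m κ) :=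
  strictMono_sortedPairs m hκ

theorem position_lt_position_iff {k k' : Fin K} {x : Fin (m k)} {y : Fin (m k')} :
    position m κ k x < position m κ k' y ↔ κ k x < κ k' y := by
  rw [← (strictMono_sortedKappa hκ).lt_iff_lt, sortedKappa_position, sortedKappa_position]

theorem position_lt_iff (hmono : ∀ k, StrictMono (κ k)) {k : Fin K} {x y : Fin (m k)} :
    position m κ k x < position m κ k y ↔ x < y := by
  rw [position_lt_position_iff hκ, (hmono k).lt_iff_lt]

end SortedPairs

section DirectSum

variable {K : ℕ} {n m : Fin K → ℕ} {κ : ∀ k, Fin (m k) → ℝ}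
  {A : ∀ k, Matrix (Fin (n k)) (Fin (m k)) ℝ}

theorem directSum_apply (i : Fin (∑ k, n k)) (k : Fin K) (x : Fin (m k)) :
    directSum n m κ A i (position m κ k x) =
      Matrix.blockDiagonal' A (rowOrder n m κ A i) ⟨k, x⟩ := by
  rw [directSum, Matrix.submatrix_apply, colOrder_position]

theorem directSum_symm_apply (k : Fin K) (a : Fin (n k)) (x : Fin (m k)) :
    directSum n m κ A ((rowOrder n m κ A).symm ⟨k, a⟩) (position m κ k x) = A k a x := by
  rw [directSum_apply, Equiv.apply_symm_apply, Matrix.blockDiagonal'_apply_eq]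

theorem directSum_apply_ne {i : Fin (∑ k, n k)} {k : Fin K} (x : Fin (m k))
    (h : (rowOrder n m κ A i).1 ≠ k) : directSum n m κ A i (position m κ k x) = 0 := by
  rw [directSum_apply]
  exact Matrix.blockDiagonal'_apply_ne _ _ _ h

section Pivots

variable (hκ : Function.Injective fun q : Σ k, Fin (m k) => κ q.1 q.2)
  (hmono : ∀ k, StrictMono (κ k)) (hA : ∀ k, IsRREF (A k))

include hmono in
theorem sInf_row_eq (k : Fin K) (a : Fin (n k)) :
    sInf (κ k '' {j | A k a j ≠ 0}) = κ k (pivotEmb (hA k) a) := by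
  refine IsLeast.csInf_eq ⟨⟨_, ?_, rfl⟩, ?_⟩
  · simp [apply_pivotEmb]
  · rintro _ ⟨j, hj, rfl⟩
    refine (hmono k).monotone (not_lt.1 fun h => hj ?_)
    exact apply_eq_zero_of_lt_pivotEmb (hA k) h

include hκ hmono in
theorem strictMono_rowPivot : StrictMono fun i => position m κ (rowOrder n m κ A i).1
    (pivotEmb (hA (rowOrder n m κ A i).1) (rowOrder n m κ A i).2) := by
  have hkey : (fun q : Σ k, Fin (n k) => sInf (κ q.1 '' {j | A q.1 q.2 j ≠ 0})) =
      fun q => κ q.1 (pivotEmb (hA q.1) q.2) := funext fun q => sInf_row_eq hmono hA q.1 q.2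
  have hinj : Function.Injective fun q : Σ k, Fin (n k) =>
      sInf (κ q.1 '' {j | A q.1 q.2 j ≠ 0}) := by
    rw [hkey]
    rintro ⟨k, a⟩ ⟨k', a'⟩ h
    have h1 := hκ (a₁ := ⟨k, pivotEmb (hA k) a⟩) (a₂ := ⟨k', pivotEmb (hA k') a'⟩) h
    obtain rfl : k = k' := congrArg Sigma.fst h1
    have h2 := (pivotEmb (hA k)).injective (eq_of_heq (Sigma.mk.inj h1).2)
    rw [h2]
  intro i i' h
  have h1 := strictMono_sortedPairs n hinj h
  change sInf (κ (rowOrder n m κ A i).1 ''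
      {j | A (rowOrder n m κ A i).1 (rowOrder n m κ A i).2 j ≠ 0}) <
    sInf (κ (rowOrder n m κ A i').1 ''
      {j | A (rowOrder n m κ A i').1 (rowOrder n m κ A i').2 j ≠ 0}) at h1
  rw [sInf_row_eq hmono hA, sInf_row_eq hmono hA] at h1
  exact (position_lt_position_iff hκ).2 h1

/-- The pivot columns of the direct sum. -/
def sumPivot : Fin (∑ k, n k) ↪o Fin (∑ k, m k) :=
  OrderEmbedding.ofStrictMono _ (strictMono_rowPivot hκ hmono hA)

theorem sumPivot_apply (i : Fin (∑ k, n k)) : sumPivot hκ hmono hA i =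
    position m κ (rowOrder n m κ A i).1
      (pivotEmb (hA (rowOrder n m κ A i).1) (rowOrder n m κ A i).2) := rfl

theorem sumPivot_symm_apply (k : Fin K) (a : Fin (n k)) :
    sumPivot hκ hmono hA ((rowOrder n m κ A).symm ⟨k, a⟩) =
      position m κ k (pivotEmb (hA k) a) := by
  have key : ∀ q : Σ k, Fin (n k), q = ⟨k, a⟩ →
      position m κ q.1 (pivotEmb (hA q.1) q.2) = position m κ k (pivotEmb (hA k) a) := by
    rintro _ rfl
    rfl
  rw [sumPivot_apply]
  exact key _ (Equiv.apply_symm_apply (rowOrder n m κ A) ⟨k, a⟩)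

theorem directSum_sumPivot (i i' : Fin (∑ k, n k)) :
    directSum n m κ A i' (sumPivot hκ hmono hA i) = if i' = i then 1 else 0 := by
  obtain ⟨⟨k, a⟩, rfl⟩ := (rowOrder n m κ A).symm.surjective i
  obtain ⟨⟨k', a'⟩, rfl⟩ := (rowOrder n m κ A).symm.surjective i'
  rw [sumPivot_symm_apply]
  by_cases h : k' = k
  · subst h
    refine (directSum_symm_apply k' a' _).trans ((apply_pivotEmb (hA k') a a').trans ?_)
    simp
  · rw [directSum_apply_ne _ (by simpa using h), if_neg fun h' => h ?_]
    exact congrArg Sigma.fst ((rowOrder n m κ A).symm.injective h')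

theorem directSum_eq_zero_of_lt {i : Fin (∑ k, n k)} {j : Fin (∑ k, m k)}
    (h : j < sumPivot hκ hmono hA i) : directSum n m κ A i j = 0 := by
  obtain ⟨k, x, rfl⟩ := exists_eq_position m κ j
  obtain ⟨⟨k', a⟩, rfl⟩ := (rowOrder n m κ A).symm.surjective i
  by_cases hk : k' = k
  · subst hk
    rw [sumPivot_symm_apply] at h
    exact (directSum_symm_apply k' a x).trans
      (apply_eq_zero_of_lt_pivotEmb (hA k') ((position_lt_iff hκ hmono).1 h))
  · exact directSum_apply_ne x (by simpa using hk)

include hκ hmono hA in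
theorem isRREF_directSum : IsRREF (directSum n m κ A) :=
  ⟨sumPivot hκ hmono hA, (sumPivot hκ hmono hA).strictMono,
    fun _ _ h => directSum_eq_zero_of_lt hκ hmono hA h,
    fun i i' => directSum_sumPivot hκ hmono hA i i'⟩

end Pivots

/-! ### Maximal minors of the direct sum -/

/-- The blocks of the columns `a`, `b` are in the opposite order to the columns. -/
def inversion (m : Fin K → ℕ) (κ : ∀ k, Fin (m k) → ℝ) (a b : Fin (∑ k, m k)) : ℕ :=
  if (colOrder m κ a).1 < (colOrder m κ b).1 ∧ b < a then 1 else 0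

/-- The column set `J` of the direct sum consists of the column sets `J' k` of the blocks. -/
def Lists (κ : ∀ k, Fin (m k) → ℝ) (J : Fin (∑ k, n k) ↪o Fin (∑ k, m k))
    (g : Fin (∑ k, n k) ≃ Σ k, Fin (n k)) (J' : ∀ k, Fin (n k) ↪o Fin (m k)) : Prop :=
  ∀ i, J i = position m κ (g i).1 (J' (g i).1 (g i).2)

variable {J : Fin (∑ k, n k) ↪o Fin (∑ k, m k)} {g : Fin (∑ k, n k) ≃ Σ k, Fin (n k)}
  {J' : ∀ k, Fin (n k) ↪o Fin (m k)}

theorem Lists.sum_eq (h : Lists κ J g J') {R : Type*} [AddCommMonoid R]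
    (F : Fin (∑ k, m k) → R) :
    ∑ i, F (J i) = ∑ k, ∑ x, F (position m κ k (J' k x)) := by
  rw [← Fintype.sum_sigma', ← Equiv.sum_comp g]
  exact Finset.sum_congr rfl fun i _ => by rw [h i]

/-- Within a block both J' and the positions are increasing, so all inversions of the shuffle are
between different blocks. -/
theorem Lists.sign_eq (hκ : Function.Injective fun q : Σ k, Fin (m k) => κ q.1 q.2)
    (hmono : ∀ k, StrictMono (κ k)) (h : Lists κ J g J') :
    Equiv.Perm.sign (g.trans finSigmaFinEquiv : Equiv.Perm (Fin (∑ k, n k))) =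
      (-1) ^ ∑ a, ∑ b, inversion m κ (J a) (J b) := by
  rw [sign_eq_neg_one_pow_inversions]
  congr 1
  refine Finset.sum_congr rfl fun a _ => Finset.sum_congr rfl fun b _ => ?_
  rw [inversion]
  refine if_congr ?_ rfl rfl
  rw [J.lt_iff_lt, h a, h b, colOrder_position, colOrder_position, and_comm]
  refine and_congr_left fun hba => ?_
  rw [Equiv.trans_apply, Equiv.trans_apply, finSigmaFinEquiv_lt_iff]
  refine ⟨fun h' => h'.resolve_right ?_, Or.inl⟩
  have hJ : J b < J a := J.strictMono hba
  rw [h a, h b] at hJ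
  generalize g a = q at hJ
  generalize g b = q' at hJ
  rintro ⟨h1, h2⟩
  obtain ⟨k, x⟩ := q
  obtain ⟨k', y⟩ := q'
  obtain rfl : k = k' := h1
  rw [position_lt_iff hκ hmono, (J' k).lt_iff_lt] at hJ
  exact absurd hJ (not_lt.2 (Fin.le_def.2 (le_of_lt h2)))

theorem det_blockDiagonal'_eq (D : ∀ k, Matrix (Fin (n k)) (Fin (n k)) ℝ) :
    (Matrix.blockDiagonal' D).det = ∏ k, (D k).det := by
  rw [(Matrix.blockTriangular_blockDiagonal' D).det_fintype]
  refine Finset.prod_congr rfl fun k _ => ?_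
  rw [← Matrix.det_submatrix_equiv_self (Equiv.sigmaSubtype k).symm]
  congr 1
  ext a b
  exact Matrix.blockDiagonal'_apply_eq D k a b

/-- Grouping rows and columns by block makes the submatrix block diagonal with square blocks; the
two signs are those of the row and column shuffles. -/
theorem Lists.maxMinor_eq (h : Lists κ J g J') :
    maxMinor (directSum n m κ A) J =
      ((Equiv.Perm.sign ((rowOrder n m κ A).trans finSigmaFinEquiv :
          Equiv.Perm (Fin (∑ k, n k))) : ℤ) : ℝ) *
        (((Equiv.Perm.sign (g.trans finSigmaFinEquiv : Equiv.Perm (Fin (∑ k, n k))) : ℤ) : ℝ) *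
          ∏ k, maxMinor (A k) (J' k)) := by
  set X := Matrix.blockDiagonal' fun k => (A k).submatrix id (J' k) with hX
  set e := finSigmaFinEquiv (n := n)
  have h1 : (directSum n m κ A).submatrix id J =
      ((X.submatrix e.symm e.symm).submatrix ((rowOrder n m κ A).trans e) id).submatrix id
        (g.trans e) := by
    ext i i'
    simp only [Matrix.submatrix_apply, id_eq, Equiv.trans_apply, Equiv.symm_apply_apply]
    rw [h i', directSum_apply]
    generalize rowOrder n m κ A i = q
    generalize g i' = q'
    obtain ⟨k, a⟩ := q
    obtain ⟨k', a'⟩ := q'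
    by_cases hk : k = k'
    · subst hk
      rw [hX, Matrix.blockDiagonal'_apply_eq, Matrix.blockDiagonal'_apply_eq]
      rfl
    · rw [hX, Matrix.blockDiagonal'_apply_ne _ _ _ hk, Matrix.blockDiagonal'_apply_ne _ _ _ hk]
  rw [maxMinor, h1, Matrix.det_permute', Matrix.det_permute, Matrix.det_submatrix_equiv_self, hX,
    det_blockDiagonal'_eq]
  simp only [maxMinor]
  ring

/-- The column set of a nonzero maximal minor of the direct sum consists of bases of the blocks. -/
theorem exists_lists {I : Fin (∑ k, n k) ↪o Fin (∑ k, m k)}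
    (hI : maxMinor (directSum n m κ A) I ≠ 0) : ∃ g J', Lists κ I g J' := by
  rw [maxMinor, Matrix.det_apply'] at hI
  -- A nonzero Leibniz term matches every selected column with a row of the same block, so block k
  -- supplies exactly n k columns.
  obtain ⟨τ, -, hτ⟩ := Finset.exists_ne_zero_of_sum_ne_zero hI
  have hne : ∀ i, directSum n m κ A (τ i) (I i) ≠ 0 := fun i =>
    Finset.prod_ne_zero_iff.1 (right_ne_zero_of_mul hτ) i (Finset.mem_univ i)
  set e := τ.trans (rowOrder n m κ A)
  have hex : ∀ k (a : Fin (n k)), ∃ x, I (e.symm ⟨k, a⟩) = position m κ k x := by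
    intro k a
    obtain ⟨k', x, hx⟩ := exists_eq_position m κ (I (e.symm ⟨k, a⟩))
    have h1 := hne (e.symm ⟨k, a⟩)
    rw [hx] at h1
    have h2 : (rowOrder n m κ A (τ (e.symm ⟨k, a⟩))).1 = k' := by
      by_contra h'
      exact h1 (directSum_apply_ne x h')
    have h3 : rowOrder n m κ A (τ (e.symm ⟨k, a⟩)) = ⟨k, a⟩ := e.apply_symm_apply _
    rw [h3] at h2
    obtain rfl : k = k' := h2
    exact ⟨x, hx⟩
  choose u hu using hex
  have hinj : ∀ k, Function.Injective (u k) := by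
    intro k a b hab
    have : I (e.symm ⟨k, a⟩) = I (e.symm ⟨k, b⟩) := by rw [hu, hu, hab]
    have := e.symm.injective (I.injective this)
    exact eq_of_heq (Sigma.mk.inj this).2
  refine ⟨e.trans (Equiv.sigmaCongrRight fun k => (Tuple.sort (u k)).symm), fun k =>
    OrderEmbedding.ofStrictMono (u k ∘ Tuple.sort (u k)) ((Tuple.monotone_sort
      (u k)).strictMono_of_injective ((hinj k).comp (Tuple.sort (u k)).injective)), fun i => ?_⟩
  obtain ⟨⟨k, a⟩, rfl⟩ := e.symm.surjective i
  rw [hu]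
  set g := e.trans (Equiv.sigmaCongrRight fun k => (Tuple.sort (u k)).symm)
  have hg : g (e.symm ⟨k, a⟩) = ⟨k, (Tuple.sort (u k)).symm a⟩ := by simp [g]
  refine Eq.trans ?_ (congrArg (fun q : Σ k, Fin (n k) =>
    position m κ q.1 (u q.1 (Tuple.sort (u q.1) q.2))) hg).symm
  simp

theorem blockPerm_position (k : Fin K) (x : Fin (m k)) :
    blockPerm n m κ A k (position m κ k x) = position m κ k (perm (A k) x) :=
  Equiv.Perm.viaEmbedding_apply _ _ _

theorem blockPerm_of_ne {k : Fin K} {j : Fin (∑ k, m k)} (h : (colOrder m κ j).1 ≠ k) :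
    blockPerm n m κ A k j = j := by
  refine Equiv.Perm.viaEmbedding_apply_of_notMem _ _ _ ?_
  rintro ⟨x, rfl⟩
  exact h (by rw [colOrder_position])

/-! ### Inversion numbers of pairs of bases -/

section Inversions

variable (hκ : Function.Injective fun q : Σ k, Fin (m k) => κ q.1 q.2)
  (hmono : ∀ k, StrictMono (κ k))
  (hnc : ∀ k k', k ≠ k' → NonCrossing (blockPerm n m κ A k) (blockPerm n m κ A k'))
include hκ hmono hnc

/-- The inversion numbers between two column sets with nonzero maximal minors. -/
theorem inversion_count {I P : Fin (∑ k, n k) ↪o Fin (∑ k, m k)}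
    {gI gP : Fin (∑ k, n k) ≃ Σ k, Fin (n k)} {I' P' : ∀ k, Fin (n k) ↪o Fin (m k)}
    (hI : Lists κ I gI I') (hP : Lists κ P gP P') (hI' : ∀ k, maxMinor (A k) (I' k) ≠ 0)
    (hP' : ∀ k, maxMinor (A k) (P' k) ≠ 0) :
    (∑ a, ∑ b, inversion m κ (I a) (I b)) + ∑ a, ∑ b, inversion m κ (P a) (P b) =
      (∑ a, ∑ b, inversion m κ (I a) (P b)) + ∑ a, ∑ b, inversion m κ (P a) (I b) := by
  -- f = 1_I - 1_P; by bilinearity the claim says that the inversion form vanishes at (f, f).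
  set f : Fin (∑ k, m k) → ℤ := fun j =>
    (∑ i, if I i = j then 1 else 0) - ∑ i, if P i = j then 1 else 0 with hf
  have hsum : ∀ G : Fin (∑ k, m k) → ℤ, ∑ j, f j * G j = ∑ i, G (I i) - ∑ i, G (P i) := by
    intro G
    simp only [hf, sub_mul, Finset.sum_sub_distrib, Finset.sum_mul]
    congr 1 <;> rw [Finset.sum_comm] <;> simp
  set S : Fin K → Finset (Fin (∑ k, m k)) := fun k =>
    Finset.univ.filter fun j => (colOrder m κ j).1 = k with hS
  have hfS : ∀ k a b, (∀ i, a ≤ i ∧ i ≤ b ↔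
      a ≤ blockPerm n m κ A k i ∧ blockPerm n m κ A k i ≤ b) →
      ∑ i ∈ S k with a ≤ i ∧ i ≤ b, f i = 0 := by
    intro k a b hinv
    have hcount : ∀ {J : Fin (∑ k, n k) ↪o Fin (∑ k, m k)}
        {g : Fin (∑ k, n k) ≃ Σ k, Fin (n k)} {J' : ∀ k, Fin (n k) ↪o Fin (m k)}
        (_ : Lists κ J g J'), (∑ i, if (colOrder m κ (J i)).1 = k ∧ a ≤ J i ∧ J i ≤ b then
          (1 : ℤ) else 0) = (Finset.univ.filter fun x =>
            a ≤ position m κ k (J' k x) ∧ position m κ k (J' k x) ≤ b).card := by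
      intro J g J' hJ
      rw [hJ.sum_eq fun j => if (colOrder m κ j).1 = k ∧ a ≤ j ∧ j ≤ b then (1 : ℤ) else 0,
        Finset.sum_eq_single k]
      · simp [colOrder_position]
      · intro k' _ hk'
        simp [colOrder_position, hk']
      · simp
    have h1 : ∑ i ∈ S k with a ≤ i ∧ i ≤ b, f i =
        ∑ j, f j * if (colOrder m κ j).1 = k ∧ a ≤ j ∧ j ≤ b then 1 else 0 := by
      rw [hS, Finset.filter_filter, Finset.sum_filter]
      exact Finset.sum_congr rfl fun j _ => by split_ifs <;> simp
    have hle : ∀ {x y : Fin (m k)}, x ≤ y → position m κ k x ≤ position m κ k y :=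
      fun h => not_lt.1 fun h' => absurd ((position_lt_iff hκ hmono).1 h') (not_lt.2 h)
    rw [h1, hsum, hcount hI, hcount hP, sub_eq_zero, Nat.cast_inj]
    refine card_filter_eq_card_filter (A k)
      (p := fun x => a ≤ position m κ k x ∧ position m κ k x ≤ b) ?_ ?_ (hI' k) (hP' k)
    · exact fun x y z hxy hyz hx hz => ⟨hx.1.trans (hle hxy), (hle hyz).trans hz.2⟩
    · intro x
      have := hinv (position m κ k x)
      rwa [blockPerm_position] at this
  have hblock : ∀ k k', k ≠ k' →
      ∑ b ∈ S k', f b * ∑ a ∈ S k with b < a, f a = 0 := by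
    intro k k' hk
    refine sum_inversions_eq_zero (hnc k k' hk) ?_ ?_ ?_ f (hfS k) (hfS k')
    · rw [Finset.disjoint_filter]
      rintro j - h1 h2
      exact hk (h1.symm.trans h2)
    · exact fun i hi => blockPerm_of_ne (by simpa [hS] using hi)
    · exact fun i hi => blockPerm_of_ne (by simpa [hS] using hi)
  -- Sorting the pairs (a, b) by their blocks splits the form into the pairwise sums of `hblock`.
  have htot : ∑ b, f b * ∑ a, f a * (inversion m κ a b : ℤ) = 0 := by
    have hinner : ∀ b, ∑ a, f a * (inversion m κ a b : ℤ) =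
        ∑ k, if k < (colOrder m κ b).1 then ∑ a ∈ S k with b < a, f a else 0 := by
      intro b
      rw [← Finset.sum_fiberwise Finset.univ (fun a => (colOrder m κ a).1)]
      refine Finset.sum_congr rfl fun k _ => ?_
      split_ifs with hk
      · rw [Finset.sum_filter (s := S k)]
        refine Finset.sum_congr rfl fun a ha => ?_
        have ha' : (colOrder m κ a).1 = k := (Finset.mem_filter.1 ha).2
        simp only [inversion, ha', hk, true_and]
        split_ifs <;> simp
      · refine Finset.sum_eq_zero fun a ha => ?_
        have ha' : (colOrder m κ a).1 = k := (Finset.mem_filter.1 ha).2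
        simp [inversion, ha', hk]
    simp only [hinner]
    rw [← Finset.sum_fiberwise Finset.univ (fun b => (colOrder m κ b).1)]
    refine Finset.sum_eq_zero fun k' _ => ?_
    calc _ = ∑ b ∈ S k', ∑ k, if k < k' then f b * ∑ a ∈ S k with b < a, f a else 0 := by
          refine Finset.sum_congr rfl fun b hb => ?_
          have hb' : (colOrder m κ b).1 = k' := (Finset.mem_filter.1 hb).2
          rw [hb', Finset.mul_sum]
          exact Finset.sum_congr rfl fun k _ => by split_ifs <;> simp
      _ = 0 := by
          rw [Finset.sum_comm]
          refine Finset.sum_eq_zero fun k _ => ?_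
          by_cases hk : k < k'
          · simp only [hk, if_true]
            exact hblock k k' hk.ne
          · simp [hk]
  rw [hsum] at htot
  simp only [hsum, Finset.sum_sub_distrib] at htot
  rw [Finset.sum_comm (f := fun x i => (inversion m κ (I i) (I x) : ℤ)),
    Finset.sum_comm (f := fun x i => (inversion m κ (P i) (I x) : ℤ)),
    Finset.sum_comm (f := fun x i => (inversion m κ (I i) (P x) : ℤ)),
    Finset.sum_comm (f := fun x i => (inversion m κ (P i) (P x) : ℤ))] at htot
  zify
  linarith

end Inversions

end DirectSum

/-! ### The sign-adjusted direct sum -/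

section Adjusted

variable {K : ℕ} {n m : Fin K → ℕ} {κ : ∀ k, Fin (m k) → ℝ}
  {A : ∀ k, Matrix (Fin (n k)) (Fin (m k)) ℝ}

/-- The sign of the column `j` relative to the columns `P`. -/
def colSign (κ : ∀ k, Fin (m k) → ℝ) (P : Fin (∑ k, n k) → Fin (∑ k, m k))
    (j : Fin (∑ k, m k)) : ℝ :=
  (-1) ^ ((∑ i, inversion m κ j (P i)) + ∑ i, inversion m κ (P i) j)

theorem colSign_mul_self (P : Fin (∑ k, n k) → Fin (∑ k, m k)) (j : Fin (∑ k, m k)) :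
    colSign κ P j * colSign κ P j = 1 := by
  rw [colSign, ← mul_pow]
  simp

theorem colSign_eq_or (P : Fin (∑ k, n k) → Fin (∑ k, m k)) (j : Fin (∑ k, m k)) :
    colSign κ P j = 1 ∨ colSign κ P j = -1 :=
  neg_one_pow_eq_or ℝ _

theorem colSign_ne_zero (P : Fin (∑ k, n k) → Fin (∑ k, m k)) (j : Fin (∑ k, m k)) :
    colSign κ P j ≠ 0 := by
  rcases colSign_eq_or (κ := κ) P j with h | h <;> simp [h]

/-- The sign adjustment of the direct sum, for the pivot columns `P`. -/
def adjusted (κ : ∀ k, Fin (m k) → ℝ) (A : ∀ k, Matrix (Fin (n k)) (Fin (m k)) ℝ)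
    (P : Fin (∑ k, n k) → Fin (∑ k, m k)) : Matrix (Fin (∑ k, n k)) (Fin (∑ k, m k)) ℝ :=
  Matrix.of fun i j => colSign κ P (P i) * (colSign κ P j * directSum n m κ A i j)

theorem signAdjustment_adjusted (P : Fin (∑ k, n k) → Fin (∑ k, m k)) :
    SignAdjustment (directSum n m κ A) (adjusted κ A P) := by
  intro i j
  rw [adjusted, Matrix.of_apply]
  rcases colSign_eq_or (κ := κ) P (P i) with h | h <;>
    rcases colSign_eq_or (κ := κ) P j with h' | h' <;> simp [h, h']

theorem maxMinor_adjusted (P : Fin (∑ k, n k) → Fin (∑ k, m k))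
    (I : Fin (∑ k, n k) ↪o Fin (∑ k, m k)) :
    maxMinor (adjusted κ A P) I = (∏ i, colSign κ P (P i)) * ((∏ i, colSign κ P (I i)) *
      maxMinor (directSum n m κ A) I) := by
  rw [maxMinor, maxMinor, ← Matrix.det_mul_row, ← Matrix.det_mul_column]
  rfl

section TNN

variable (hκ : Function.Injective fun q : Σ k, Fin (m k) => κ q.1 q.2)
  (hmono : ∀ k, StrictMono (κ k))

theorem isRREF_adjusted (hA : ∀ k, IsRREF (A k)) :
    IsRREF (adjusted κ A (sumPivot hκ hmono hA)) := by
  refine ⟨sumPivot hκ hmono hA, (sumPivot hκ hmono hA).strictMono, fun i j h => ?_,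
    fun i i' => ?_⟩
  · rw [adjusted, Matrix.of_apply, directSum_eq_zero_of_lt hκ hmono hA h]
    simp
  · rw [adjusted, Matrix.of_apply, directSum_sumPivot]
    split_ifs with h
    · rw [h, mul_one, colSign_mul_self]
    · simp

theorem lists_sumPivot (hA : ∀ k, IsRREF (A k)) :
    Lists κ (sumPivot hκ hmono hA) (rowOrder n m κ A) fun k => pivotEmb (hA k) :=
  sumPivot_apply hκ hmono hA

/-- The signs of the rows and columns cancel those of the two shuffles by `inversion_count`, which
leaves the product of the block minors. -/
theorem isTNN_adjusted (hA : ∀ k, IsTNN (A k))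
    (hnc : ∀ k k', k ≠ k' → NonCrossing (blockPerm n m κ A k) (blockPerm n m κ A k')) :
    IsTNN (adjusted κ A (sumPivot hκ hmono fun k => (hA k).1)) := by
  refine ⟨isRREF_adjusted hκ hmono _, fun I hI => ?_⟩
  set P := sumPivot hκ hmono fun k => (hA k).1 with hPdef
  have hP : Lists κ P (rowOrder n m κ A) fun k => pivotEmb (hA k).1 := lists_sumPivot hκ hmono _
  have hB : maxMinor (directSum n m κ A) I ≠ 0 := by
    intro h0
    rw [matroid, Set.mem_ofPred_eq, maxMinor_adjusted, h0] at hI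
    simp at hI
  obtain ⟨g, I', hL⟩ := exists_lists hB
  have hprod : ∏ k, maxMinor (A k) (I' k) ≠ 0 := by
    rw [hL.maxMinor_eq] at hB
    exact right_ne_zero_of_mul (right_ne_zero_of_mul hB)
  have hI' : ∀ k, maxMinor (A k) (I' k) ≠ 0 := fun k =>
    Finset.prod_ne_zero_iff.1 hprod k (Finset.mem_univ k)
  have hcount := inversion_count hκ hmono hnc hL hP hI' fun k => by
    rw [maxMinor_pivotEmb]
    exact one_ne_zero
  have hcol : ∀ J : Fin (∑ k, n k) → Fin (∑ k, m k), ∏ i, colSign κ P (J i) =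
      (-1) ^ ((∑ a, ∑ b, inversion m κ (J a) (P b)) + ∑ a, ∑ b, inversion m κ (P a) (J b)) := by
    intro J
    rw [Finset.sum_comm (f := fun a b => inversion m κ (P a) (J b)), ← Finset.sum_add_distrib,
      ← Finset.prod_pow_eq_pow_sum]
    rfl
  rw [maxMinor_adjusted, hcol, hcol, hL.maxMinor_eq, hP.sign_eq hκ hmono, hL.sign_eq hκ hmono,
    ← hcount]
  have hpos : 0 < ∏ k, maxMinor (A k) (I' k) :=
    Finset.prod_pos fun k _ => (hA k).2 (I' k) (hI' k)
  generalize ∑ a, ∑ b, inversion m κ (P a) (P b) = x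
  generalize ∑ a, ∑ b, inversion m κ (I a) (I b) = y
  push_cast
  have hx : ((-1 : ℝ) ^ x) * (-1) ^ x = 1 := by rw [← mul_pow]; simp
  have hy : ((-1 : ℝ) ^ y) * (-1) ^ y = 1 := by rw [← mul_pow]; simp
  have : (-1 : ℝ) ^ (x + x) * ((-1) ^ (y + x) * ((-1) ^ x * ((-1) ^ y *
      ∏ k, maxMinor (A k) (I' k)))) = ∏ k, maxMinor (A k) (I' k) := by
    rw [pow_add, pow_add, hx]
    linear_combination ((-1 : ℝ) ^ x * (-1) ^ x * ∏ k, maxMinor (A k) (I' k)) * hy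
      + (∏ k, maxMinor (A k) (I' k)) * hx
  rw [this]
  exact hpos

end TNN

/-! ### The permutation of the direct sum -/

section Permutation

variable (P : Fin (∑ k, n k) → Fin (∑ k, m k))

/-- The coordinates of the block `k`, with the signs of the rows. -/
def blockProj (κ : ∀ k, Fin (m k) → ℝ) (A : ∀ k, Matrix (Fin (n k)) (Fin (m k)) ℝ) (k : Fin K) :
    (Fin (∑ k, n k) → ℝ) →ₗ[ℝ] (Fin (n k) → ℝ) :=
  LinearMap.pi fun a => colSign κ P (P ((rowOrder n m κ A).symm ⟨k, a⟩)) •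
    LinearMap.proj ((rowOrder n m κ A).symm ⟨k, a⟩)

/-- The embedding of the coordinates of the block `k`, with the signs of the rows. -/
def blockEmb (κ : ∀ k, Fin (m k) → ℝ) (A : ∀ k, Matrix (Fin (n k)) (Fin (m k)) ℝ) (k : Fin K) :
    (Fin (n k) → ℝ) →ₗ[ℝ] (Fin (∑ k, n k) → ℝ) :=
  Matrix.mulVecLin (Matrix.of fun i a =>
    if rowOrder n m κ A i = ⟨k, a⟩ then colSign κ P (P i) else 0)

theorem adjusted_apply_same (k : Fin K) (a : Fin (n k)) (x : Fin (m k)) :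
    adjusted κ A P ((rowOrder n m κ A).symm ⟨k, a⟩) (position m κ k x) =
      colSign κ P (P ((rowOrder n m κ A).symm ⟨k, a⟩)) *
        (colSign κ P (position m κ k x) * A k a x) :=
  congrArg (fun y => _ * (_ * y)) (directSum_symm_apply k a x)

theorem adjusted_apply_ne {k k' : Fin K} (h : k' ≠ k) (a : Fin (n k')) (x : Fin (m k)) :
    adjusted κ A P ((rowOrder n m κ A).symm ⟨k', a⟩) (position m κ k x) = 0 := by
  rw [adjusted, Matrix.of_apply, directSum_apply_ne x (by simpa using h)]
  simp

theorem blockProj_col_same (k : Fin K) (x : Fin (m k)) :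
    blockProj P κ A k ((adjusted κ A P).col (position m κ k x)) =
      colSign κ P (position m κ k x) • (A k).col x := by
  ext a
  simp only [blockProj, LinearMap.pi_apply, LinearMap.smul_apply, LinearMap.proj_apply,
    Matrix.col_apply, smul_eq_mul, Pi.smul_apply]
  rw [adjusted_apply_same, ← mul_assoc, colSign_mul_self, one_mul]

theorem blockProj_col_ne {k k' : Fin K} (h : k ≠ k') (x : Fin (m k')) :
    blockProj P κ A k ((adjusted κ A P).col (position m κ k' x)) = 0 := by
  ext a
  simp only [blockProj, LinearMap.pi_apply, LinearMap.smul_apply, LinearMap.proj_apply,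
    Matrix.col_apply, smul_eq_mul, Pi.zero_apply]
  rw [adjusted_apply_ne P h, mul_zero]

theorem blockEmb_col (k : Fin K) (x : Fin (m k)) :
    blockEmb P κ A k ((A k).col x) =
      colSign κ P (position m κ k x) • (adjusted κ A P).col (position m κ k x) := by
  ext i
  obtain ⟨⟨k', a⟩, rfl⟩ := (rowOrder n m κ A).symm.surjective i
  simp only [blockEmb, Matrix.mulVecLin_apply, Matrix.mulVec, dotProduct, Matrix.of_apply,
    Equiv.apply_symm_apply, Matrix.col_apply, Pi.smul_apply, smul_eq_mul]
  by_cases h : k' = k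
  · subst h
    rw [adjusted_apply_same]
    simp only [Sigma.mk.injEq, heq_eq_eq, true_and, ite_mul, zero_mul, Finset.sum_ite_eq,
      Finset.mem_univ, if_true]
    linear_combination -(colSign κ P (P ((rowOrder n m κ A).symm ⟨k', a⟩)) * A k' a x) *
      colSign_mul_self P (position m κ k' x)
  · rw [adjusted_apply_ne P h]
    simp [h]

variable (hκ : Function.Injective fun q : Σ k, Fin (m k) => κ q.1 q.2)
  (hmono : ∀ k, StrictMono (κ k))

include hκ hmono in
theorem closerBack_position_iff {k : Fin K} {x i j : Fin (m k)} :
    CloserBack (position m κ k x) (position m κ k i) (position m κ k j) ↔ CloserBack x i j := by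
  simp only [CloserBack, ← not_lt, position_lt_iff hκ hmono]

include hκ hmono in
/-- The permutation of the sign-adjusted direct sum acts on each block as the permutation of the
block. -/
theorem perm_adjusted_position (k : Fin K) (x : Fin (m k)) :
    perm (adjusted κ A P) (position m κ k x) = position m κ k (perm (A k) x) := by
  refine (permSpec_perm (adjusted κ A P) (position m κ k x)).unique ?_
  have hspec := permSpec_perm (A k) x
  generalize perm (A k) x = i at hspec ⊢
  have hcol : ∀ y, (adjusted κ A P).col (position m κ k y) =
      colSign κ P (position m κ k y) • blockEmb P κ A k ((A k).col y) := fun y => by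
    rw [blockEmb_col, smul_smul, colSign_mul_self, one_smul]
  rcases hspec with ⟨h0, rfl⟩ | ⟨h1, h2⟩
  · left
    rw [hcol, h0, map_zero, smul_zero]
    exact ⟨rfl, rfl⟩
  · right
    constructor
    -- `blockEmb` carries a relation within the block to the large matrix, where the intervening
    -- columns of other blocks only enlarge the span.
    · rw [hcol]
      refine Submodule.smul_mem _ _ ?_
      have h3 := Submodule.mem_map_of_mem (f := blockEmb P κ A k) h1
      rw [Submodule.map_span] at h3
      refine Submodule.span_le.2 ?_ h3
      rintro _ ⟨_, ⟨y, hy, rfl⟩, rfl⟩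
      rw [blockEmb_col]
      refine Submodule.smul_mem _ _ (Submodule.subset_span ⟨position m κ k y, ?_, rfl⟩)
      rcases hy with hy | rfl
      · exact Or.inl ((closerBack_position_iff hκ hmono).2 hy)
      · exact Or.inr rfl
    -- Conversely `blockProj` annihilates the columns of the other blocks, so a relation in the
    -- large matrix restricts to the block.
    · intro h3
      apply h2
      have h4 := Submodule.mem_map_of_mem (f := blockProj P κ A k) h3
      rw [Submodule.map_span, blockProj_col_same,
        Submodule.smul_mem_iff _ (colSign_ne_zero P _)] at h4
      refine Submodule.span_le.2 ?_ h4
      rintro _ ⟨_, ⟨j, hj, rfl⟩, rfl⟩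
      obtain ⟨k', y, rfl⟩ := exists_eq_position m κ j
      by_cases hk : k = k'
      · subst hk
        rw [blockProj_col_same]
        exact Submodule.smul_mem _ _ (Submodule.subset_span
          ⟨y, (closerBack_position_iff hκ hmono).1 hj, rfl⟩)
      · rw [blockProj_col_ne P hk]
        exact Submodule.zero_mem _

theorem prod_blockPerm_position (l : List (Fin K)) (hl : l.Nodup) (k : Fin K) (x : Fin (m k)) :
    (l.map fun k => blockPerm n m κ A k).prod (position m κ k x) =
      position m κ k (if k ∈ l then perm (A k) x else x) := by
  induction l with
  | nil => simp
  | cons k' l ih =>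
    rw [List.nodup_cons] at hl
    rw [List.map_cons, List.prod_cons, Equiv.Perm.mul_apply, ih hl.2]
    by_cases h : k = k'
    · subst h
      rw [if_neg hl.1, if_pos List.mem_cons_self, blockPerm_position]
    · rw [blockPerm_of_ne (by rwa [colOrder_position])]
      simp [h]

include hκ hmono in
theorem perm_adjusted : perm (adjusted κ A P) =
    (List.ofFn fun k => blockPerm n m κ A k).prod := by
  ext j
  obtain ⟨k, x, rfl⟩ := exists_eq_position m κ j
  rw [List.ofFn_eq_map, prod_blockPerm_position _ (List.nodup_finRange K),
    if_pos (List.mem_finRange k), perm_adjusted_position P hκ hmono]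

theorem isIrreducible_adjusted (hirr : ∀ k, IsIrreducible (A k)) :
    IsIrreducible (adjusted κ A P) := by
  have hne : ∀ k a x, A k a x ≠ 0 →
      adjusted κ A P ((rowOrder n m κ A).symm ⟨k, a⟩) (position m κ k x) ≠ 0 := by
    intro k a x h
    rw [adjusted_apply_same]
    exact mul_ne_zero (colSign_ne_zero _ _) (mul_ne_zero (colSign_ne_zero _ _) h)
  constructor
  · intro j
    obtain ⟨k, x, rfl⟩ := exists_eq_position m κ j
    obtain ⟨a, ha⟩ := (hirr k).1 x
    exact ⟨_, hne k a x ha⟩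
  · intro i
    obtain ⟨⟨k, a⟩, rfl⟩ := (rowOrder n m κ A).symm.surjective i
    obtain ⟨x, y, hxy, hx, hy⟩ := (hirr k).2 a
    exact ⟨_, _, fun h => hxy ((position m κ k).injective h), hne k a x hx, hne k a y hy⟩

end Permutation

end Adjusted

end KPSoliton

end

/-! ### The main theorem -/

theorem theorem3p2 (K : ℕ) (ℓ : ℕ+) (c : ℕ+ → ℝ) (α : Fin K → ℝ) (hα : Function.Injective α)
    (n m : Fin K → ℕ) (κ : ∀ k, Fin (m k) → ℝ) (hκ : ∀ k, StrictMono (κ k))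
    (hroot : ∀ k j, (KPSoliton.spectralCurve ℓ c (α k)).IsRoot (κ k j))
    (A : ∀ k, Matrix (Fin (n k)) (Fin (m k)) ℝ) (hA : ∀ k, KPSoliton.IsTNN (A k))
    (hnc : ∀ k k', k ≠ k' →
      KPSoliton.NonCrossing (KPSoliton.blockPerm n m κ A k) (KPSoliton.blockPerm n m κ A k')) :
    KPSoliton.IsRREF (KPSoliton.directSum n m κ A) ∧
    ∃ A' : Matrix (Fin (∑ k, n k)) (Fin (∑ k, m k)) ℝ,
      -- the sign-adjusted matrix is totally nonnegative, and it is the only such matrix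
      KPSoliton.SignAdjustment (KPSoliton.directSum n m κ A) A' ∧ KPSoliton.IsTNN A' ∧
      (∀ A'', KPSoliton.SignAdjustment (KPSoliton.directSum n m κ A) A'' →
        KPSoliton.IsTNN A'' → A'' = A') ∧
      -- its permutation is the product of those of the blocks
      KPSoliton.perm A' = (List.ofFn fun k => KPSoliton.blockPerm n m κ A k).prod ∧
      ((∀ k, KPSoliton.IsIrreducible (A k)) →
        KPSoliton.IsIrreducible A' ∧ ∀ j, KPSoliton.perm A' j ≠ j) ∧
      -- it gives a regular KP soliton of the `ℓ`-reduction
      KPSoliton.IsKPSoliton (KPSoliton.sortedKappa m κ) A' ∧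
      KPSoliton.IsReduced ℓ c (fun i => α (KPSoliton.rowOrder n m κ A i).1)
        (KPSoliton.sortedKappa m κ) A' := by
  have hval : ∀ k j, κ k j ^ (ℓ : ℕ) - ∑ r ∈ Finset.Ico 1 ℓ, c r * κ k j ^ (r : ℕ) = α k := by
    intro k j
    have h := hroot k j
    rw [Polynomial.IsRoot, KPSoliton.spectralCurve] at h
    simp only [Polynomial.eval_sub, Polynomial.eval_pow, Polynomial.eval_X, Polynomial.eval_C,
      Polynomial.eval_finsetSum, Polynomial.eval_mul] at h
    linarith
  -- A number κ determines the value of the spectral polynomial and thus α; since the α are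
  -- distinct, different blocks share no parameter.
  have hinj : Function.Injective fun q : Σ k, Fin (m k) => κ q.1 q.2 := by
    rintro ⟨k, x⟩ ⟨k', y⟩ h
    have hk : k = k' := hα (by rw [← hval k x, ← hval k' y, show κ k x = κ k' y from h])
    subst hk
    have hxy : x = y := (hκ k).injective h
    rw [hxy]
  set P := KPSoliton.sumPivot hinj hκ fun k => (hA k).1
  have hadj := KPSoliton.signAdjustment_adjusted (κ := κ) (A := A) P
  have hTNN : KPSoliton.IsTNN (KPSoliton.adjusted κ A P) :=
    KPSoliton.isTNN_adjusted hinj hκ hA hnc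
  have hmono := KPSoliton.strictMono_sortedKappa hinj
  have hpos := KPSoliton.det_waveMat_pos hmono hTNN
  refine ⟨KPSoliton.isRREF_directSum hinj hκ fun k => (hA k).1, KPSoliton.adjusted κ A P, hadj,
    hTNN, fun A'' hadj' hTNN' => hTNN'.eq_of_abs_eq hTNN fun i j => ?_,
    KPSoliton.perm_adjusted P hinj hκ, fun hirr => ?_,
    KPSoliton.isKPSoliton_of_det_pos hpos hmono,
    KPSoliton.isReduced_of_support ℓ c _ (fun i j hij => ?_) hpos⟩
  · rcases hadj i j with h | h <;> rcases hadj' i j with h' | h' <;> simp [h, h']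
  · have h := KPSoliton.isIrreducible_adjusted (κ := κ) P hirr
    exact ⟨h, KPSoliton.perm_apply_ne hTNN.1 h⟩
  · obtain ⟨k, x, rfl⟩ := KPSoliton.exists_eq_position m κ j
    rw [KPSoliton.sortedKappa_position, hval]
    obtain ⟨⟨k', a⟩, rfl⟩ := (KPSoliton.rowOrder n m κ A).symm.surjective i
    rw [Equiv.apply_symm_apply]
    by_contra hne
    exact hij (KPSoliton.adjusted_apply_ne P (fun h => hne (by subst h; rfl)) a x)
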